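/- For each sample size $n\ge 1$ let $Y=FA+U$, where $Y$ is $n\times p$, $F$ is $n\times K$ with rows $f_t'$, $A=(a_1,\dots,a_p)$ is a deterministic $K\times p$ matrix and $U$ is $n\times p$ with rows $u_t'=(u_{1t},\dots,u_{pt})$; thus $y_{jt}=f_t'a_j+u_{jt}$. Here $p=p(n)$, $K=K(n)\ge1$, and all objects may depend on $n$. For $1\le j\le p$ let $U_{-jt}$ be $u_t$ without its $j$-th entry and $A_{-j}$ the $(p-1)\times K$ matrix with rows $a_i'$, $i\neq j$. Put $\Sigma_f=\mathrm{cov}(f_t)$, $\sigma_j^2=\mathrm{var}(u_{jt})$, $\Sigma_{U,-j}=\mathrm{var}(U_{-jt})$, $\Sigma=\mathrm{cov}(y_t)$, $\Theta=\Sigma^{-1}$ and $\tau_j^2=1/\Theta_{jj}$. Let $\|\cdot\|_2$ be the spectral (Euclidean) norm, $\lambda_K$ the $K$-th largest eigenvalue, and $$\bar\xi=\min_j\frac{\lambda_K(A_{-j}\Sigma_fA_{-j}')}{\|\Sigma_{U,-j}\|_2},\quad d_{2n}=\max_j\|a_j'\Sigma_fA_{-j}'\|_2,\quad \delta_n=\min_j\|\Sigma_{U,-j}\|_2,\quad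 r_n=\max_j\|\Sigma_{U,-j}\|_2 .$$ A random variable $X$ is called $\gamma$-sub-Gaussian if $E e^{sX}\le e^{s^2\gamma^2/2}$ for all $s\in\mathbb R$, and a random vector $X$ is called $\gamma$-sub-Gaussian if $v'X$ is, for every unit vector $v$. Assume that there are constants $c,C,C_p>0$ and $\gamma_e,\gamma_w,\gamma_f$, not depending on $n$, such that for all $n\ge1$: 1. $(y_t)_t$, $(u_t)_t$ and $(f_t)_t$ are each iid across $t=1,\dots,n$; $E u_t=0$; and for every $t$ and $j$ the three variables $f_t,u_{jt},U_{-jt}$ are mutually independent. 2. For all $j$, the smallest eigenvalue of $\Sigma_{U,-j}$ is at least $c$ and $c\le\sigma_j^2\le C$; $\delta_n$ and $r_n$ are nondecreasing in $n$, and $r_n/p\to0$. 3. $p-1>n$ (the interpolation case), $p\le e^{C_pn/2}/4$, $p>K+1$; every $A_{-j}$ and $\Sigma_f$ have rank $K$; the largest eigenvalue of $\Sigma_f$ is at most $C$; and $\max_j\|A_{-j}\|_2=O(d_{1n})$ for some $d_{1n}\to\infty$ with $d_{1n}/\sqrt p\to0$. 4. Each $u_{jt}$ is $\sigma_j\gamma_e$-sub-Gaussian;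 $U_{-jt}=\Sigma_{U,-j}^{1/2}\tilde U_{-jt}$ with $\tilde U_{-jt}$ $\gamma_w$-sub-Gaussian and $E\tilde U_{-jt}\tilde U_{-jt}'=I_{p-1}$; $f_t=\Sigma_f^{1/2}\tilde f_t$ with $\tilde f_t-E\tilde f_t$ $\gamma_f$-sub-Gaussian and $E\tilde f_t\tilde f_t'=I_K$; $|Ef_{tk}|\le C$ for all $k$; and all entries of $A$ are bounded by $C$ in absolute value. Let $\hat\tau^2_{INT,j}=y_j'y_j/n=\frac1n\sum_{t=1}^n y_{jt}^2$. Then, as $n\to\infty$: (i) $$\max_{1\le j\le p}|\hat\tau^2_{INT,j}-\tau_j^2|=O_p\Big(\frac{\sqrt K\,d_{2n}}{\sqrt{\bar\xi}}\Big)+O_p\Big(\max\Big(\frac{K^{3/2}}{\sqrt n},\,K\sqrt{\frac{\log p}{n}}\Big)\Big).$$ If moreover $\sqrt{K^3/n}\to0$, $K\sqrt{\max(\log p,\log n)}/\sqrt n\to0$ and $\sqrt K\,d_{2n}/\sqrt{\bar\xi}\to0$, then (ii) $\max_{1\le j\le p}|\hat\tau^2_{INT,j}-\tau_j^2|=o_p(1)$,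 and (iii) $\min_{1\le j\le p}\tau_j^2\ge c-o_p(1)$. -/

import Mathlib

open MeasureTheory ProbabilityTheory Filter Topology

noncomputable section

namespace HiddenFactor

/-! ### Linear algebra -/

section LinearAlgebra

open scoped Matrix.Norms.L2Operator in
/-- Spectral norm of a (rectangular) real matrix. -/
def specNorm {m k : Type*} [Fintype m] [Fintype k] [DecidableEq k] (M : Matrix m k ℝ) : ℝ := ‖M‖

/-- Euclidean norm of a real vector. -/
def eucNorm {m : Type*} [Fintype m] (v : m → ℝ) : ℝ := ‖WithLp.toLp 2 v‖

open Classical in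
/-- The `k`-th largest eigenvalue (with multiplicity, `k = 1` being the largest) of a symmetric
real matrix; `0` if the matrix is not symmetric or `k` is out of range. -/
def kthEig {m : Type*} [Fintype m] [DecidableEq m] (M : Matrix m m ℝ) (k : ℕ) : ℝ :=
  if h : M.IsHermitian ∧ 1 ≤ k ∧ k ≤ Fintype.card m then
    h.1.eigenvalues₀ ⟨k - 1, by omega⟩
  else 0

/-- Largest eigenvalue. -/
def eigMax {m : Type*} [Fintype m] [DecidableEq m] (M : Matrix m m ℝ) : ℝ := kthEig M 1

/-- Smallest eigenvalue. -/
def eigMin {m : Type*} [Fintype m] [DecidableEq m] (M : Matrix m m ℝ) : ℝ :=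
  kthEig M (Fintype.card m)

/-- `S` is the symmetric positive semidefinite square root `M ^ (1/2)` of `M`. -/
def IsPsdSqrt {m : Type*} [Fintype m] (S M : Matrix m m ℝ) : Prop :=
  S.PosSemidef ∧ S * S = M

end LinearAlgebra

/-! ### Probability -/

section Probability

/-- Covariance matrix of a random vector. -/
def covMat {Ω ι : Type*} [MeasurableSpace Ω] (P : Measure Ω) (X : Ω → ι → ℝ) : Matrix ι ι ℝ :=
  Matrix.of fun i j => covariance (fun ω => X ω i) (fun ω => X ω j) P

/-- The common covariance matrix of identically distributed random vectors `X 0, …, X (n-1)`,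
computed from the first of them. -/
def rowCov {Ω ι : Type*} [MeasurableSpace Ω] (P : Measure Ω) {n : ℕ} (X : Fin n → Ω → ι → ℝ) :
    Matrix ι ι ℝ :=
  if h : 0 < n then covMat P (X ⟨0, h⟩) else 0

/-- The random elements `X 0, …, X (n-1)` are independent and identically distributed. -/
def IsIID {Ω E : Type*} [MeasurableSpace Ω] [MeasurableSpace E] (P : Measure Ω) {n : ℕ}
    (X : Fin n → Ω → E) : Prop :=
  iIndepFun X P ∧ ∀ s t, IdentDistrib (X s) (X t) P P

/-- The random variable `X` is (zero mean) `γ`-sub-Gaussian: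
`E exp (s X) ≤ exp (s ^ 2 γ ^ 2 / 2)` for all real `s`. -/
def IsSubG {Ω : Type*} [MeasurableSpace Ω] (P : Measure Ω) (γ : ℝ) (X : Ω → ℝ) : Prop :=
  HasSubgaussianMGF X (Real.toNNReal (γ ^ 2)) P

/-- The random vector `X` is `γ`-sub-Gaussian: so is `v' X` for every unit vector `v`. -/
def IsSubGVec {Ω ι : Type*} [Fintype ι] [MeasurableSpace Ω] (P : Measure Ω) (γ : ℝ)
    (X : Ω → ι → ℝ) : Prop :=
  ∀ v : ι → ℝ, eucNorm v = 1 → IsSubG P γ (fun ω => v ⬝ᵥ X ω)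

/-- `E X X' = I`. -/
def IsotropicVec {Ω ι : Type*} [DecidableEq ι] [MeasurableSpace Ω] (P : Measure Ω)
    (X : Ω → ι → ℝ) : Prop :=
  ∀ i k, (∫ ω, X ω i * X ω k ∂P) = if i = k then 1 else 0

/-- `X n = O_p (a n)`. -/
def IsBigOp {Ω : ℕ → Type*} [∀ n, MeasurableSpace (Ω n)] (P : ∀ n, Measure (Ω n))
    (X : ∀ n, Ω n → ℝ) (a : ℕ → ℝ) : Prop :=
  ∀ ε : ℝ, 0 < ε → ∃ B : ℝ, ∀ᶠ n in atTop,
    P n {ω | B * |a n| < |X n ω|} ≤ ENNReal.ofReal ε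

/-- `X n = o_p (1)`. -/
def IsLittleOpOne {Ω : ℕ → Type*} [∀ n, MeasurableSpace (Ω n)] (P : ∀ n, Measure (Ω n))
    (X : ∀ n, Ω n → ℝ) : Prop :=
  ∀ ε : ℝ, 0 < ε → Tendsto (fun n => P n {ω | ε < |X n ω|}) atTop (𝓝 0)

end Probability

/-! ### The hidden factor model -/

/-- Data of the model `Y = F A + U` with `n` time periods, `p` outcomes and `K` hidden factors:
the loading matrix `A`, the factor vectors `f t` (rows of `F`) and the error vectors
`u t` (rows of `U`). -/
structure FactorModel (Ω : Type*) (n p K : ℕ) where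
  A : Matrix (Fin K) (Fin p) ℝ
  f : Fin n → Ω → Fin K → ℝ
  u : Fin n → Ω → Fin p → ℝ

namespace FactorModel

variable {Ω : Type*} {n p K : ℕ} (M : FactorModel Ω n p K)

/-- Outcomes: `y t ω j = f_t' a_j + u_{jt}`. -/
def y (t : Fin n) (ω : Ω) (j : Fin p) : ℝ := (M.f t ω ⬝ᵥ fun k => M.A k j) + M.u t ω j

/-- `a_j`, the `j`-th column of `A`. -/
def a (j : Fin p) : Fin K → ℝ := fun k => M.A k j

/-- `A_{-j}`: the rows are the loading vectors of the outcomes other than `j`. -/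
def Aminus (j : Fin p) : Matrix {i : Fin p // i ≠ j} (Fin K) ℝ := Matrix.of fun i k => M.A k i

/-- `U_{-j,t}`: the error vector without its `j`-th entry. -/
def uMinus (j : Fin p) (t : Fin n) (ω : Ω) : {i : Fin p // i ≠ j} → ℝ := fun i => M.u t ω i

/-- The diagonal estimator `y_j' y_j / n`. -/
def tauHatSq (j : Fin p) (ω : Ω) : ℝ := (∑ t, M.y t ω j * M.y t ω j) / n

variable [MeasurableSpace Ω] (P : Measure Ω)

/-- `Σ_f = cov (f_t)`. -/
def SigmaF : Matrix (Fin K) (Fin K) ℝ := rowCov P M.f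

/-- `σ_j² = var (u_{jt})`. -/
def sigmaSq (j : Fin p) : ℝ := rowCov P M.u j j

/-- `Σ_{U,-j} = var (U_{-j,t})`. -/
def SigmaUminus (j : Fin p) : Matrix {i : Fin p // i ≠ j} {i : Fin p // i ≠ j} ℝ :=
  rowCov P (M.uMinus j)

/-- `Σ = E (y_t - μ) (y_t - μ)'`. -/
def Sigma : Matrix (Fin p) (Fin p) ℝ := rowCov P M.y

/-- The precision matrix `Θ = Σ⁻¹`. -/
def Theta : Matrix (Fin p) (Fin p) ℝ := (M.Sigma P)⁻¹

/-- `τ_j²`, the reciprocal of the `j`-th main diagonal term of the precision matrix. -/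
def tauSq (j : Fin p) : ℝ := 1 / M.Theta P j j

/-- `δ_n = min_j ‖Σ_{U,-j}‖₂`. -/
def delta : ℝ := ⨅ j, specNorm (M.SigmaUminus P j)

/-- `r_n = max_j ‖Σ_{U,-j}‖₂`. -/
def r : ℝ := ⨆ j, specNorm (M.SigmaUminus P j)

/-- Signal-to-noise ratio `ξ_j = λ_K (A_{-j} Σ_f A_{-j}') / ‖Σ_{U,-j}‖₂`. -/
def xi (j : Fin p) : ℝ :=
  kthEig (M.Aminus j * M.SigmaF P * (M.Aminus j).transpose) K / specNorm (M.SigmaUminus P j)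

/-- Uniform signal-to-noise ratio `min_j ξ_j`. -/
def xiBar : ℝ := ⨅ j, M.xi P j

/-- `d_{2n} = max_j ‖a_j' Σ_f A_{-j}'‖₂`. -/
def d2 : ℝ :=
  ⨆ j, eucNorm (Matrix.vecMul (M.a j) (M.SigmaF P * (M.Aminus j).transpose))

/-- `max_j |τ̂_j² - τ_j²|`. -/
def maxErr (ω : Ω) : ℝ := ⨆ j, |M.tauHatSq j ω - M.tauSq P j|

/-- Sampling scheme: outcomes, errors and factors are iid across time, the errors have mean zero,
and `f_t`, `u_{jt}`, `U_{-j,t}` are mutually independent for every `j`. -/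
structure Sampling : Prop where
  measurable_f : ∀ t, Measurable (M.f t)
  measurable_u : ∀ t, Measurable (M.u t)
  iid_y : IsIID P M.y
  iid_u : IsIID P M.u
  integrable_u : ∀ t j, Integrable (fun ω => M.u t ω j) P
  mean_u : ∀ t j, (∫ ω, M.u t ω j ∂P) = 0
  iid_f : IsIID P M.f
  indep : ∀ t j, iIndep
    ![MeasurableSpace.comap (M.f t) inferInstance,
      MeasurableSpace.comap (fun ω => M.u t ω j) inferInstance,
      MeasurableSpace.comap (M.uMinus j t) inferInstance] P

/-- Eigenvalue and variance bounds on the noise. -/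
structure NoiseBounds (c C : ℝ) : Prop where
  eigMin_ge : ∀ j, c ≤ eigMin (M.SigmaUminus P j)
  sigmaSq_le : ∀ j, M.sigmaSq P j ≤ C
  sigmaSq_ge : ∀ j, c ≤ M.sigmaSq P j

/-- Rank conditions on the loadings and on the factor covariance matrix. -/
structure RankBounds (C : ℝ) : Prop where
  rank_A : ∀ j, (M.Aminus j).rank = K
  dim : K + 1 < p
  rank_F : (M.SigmaF P).rank = K
  eigMax_F : eigMax (M.SigmaF P) ≤ C

/-- Sub-Gaussian errors and factors, bounded factor means, bounded loadings. -/
structure SubGaussianDesign (C γe γw γf : ℝ) : Prop where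
  subG_u : ∀ t j, IsSubG P (Real.sqrt (M.sigmaSq P j) * γe) (fun ω => M.u t ω j)
  subG_U : ∀ j, ∃ S, IsPsdSqrt S (M.SigmaUminus P j) ∧
    ∀ t, ∃ V : Ω → {i : Fin p // i ≠ j} → ℝ, Measurable V ∧
      (∀ ω, M.uMinus j t ω = S.mulVec (V ω)) ∧ IsSubGVec P γw V ∧ IsotropicVec P V
  subG_f : ∃ S, IsPsdSqrt S (M.SigmaF P) ∧
    ∀ t, ∃ g : Ω → Fin K → ℝ, Measurable g ∧
      (∀ ω, M.f t ω = S.mulVec (g ω)) ∧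
      IsSubGVec P γf (fun ω k => g ω k - ∫ ω', g ω' k ∂P) ∧ IsotropicVec P g
  mean_f : ∀ t k, |∫ ω, M.f t ω k ∂P| ≤ C
  bdd_A : ∀ k j, |M.A k j| ≤ C

end FactorModel

/-- The standing assumptions on a sequence of models, indexed by the sample size `n ≥ 1`, in the
interpolation case `p - 1 > n`. The constants do not depend on `n`. -/
structure Assumptions {Ω : ℕ → Type*} [∀ n, MeasurableSpace (Ω n)] (P : ∀ n, Measure (Ω n))
    (p K : ℕ → ℕ) (M : ∀ n, FactorModel (Ω n) n (p n) (K n))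
    (d₁ : ℕ → ℝ) (c C Cp γe γw γf : ℝ) : Prop where
  c_pos : 0 < c
  Cp_pos : 0 < Cp
  K_pos : ∀ n, 1 ≤ n → 1 ≤ K n
  interpolation : ∀ n, 1 ≤ n → n + 1 < p n
  sampling : ∀ n, 1 ≤ n → (M n).Sampling (P n)
  noise : ∀ n, 1 ≤ n → (M n).NoiseBounds (P n) c C
  delta_mono : MonotoneOn (fun n => (M n).delta (P n)) (Set.Ici 1)
  r_mono : MonotoneOn (fun n => (M n).r (P n)) (Set.Ici 1)
  r_small : Tendsto (fun n => (M n).r (P n) / p n) atTop (𝓝 0)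
  p_le : ∀ n, 1 ≤ n → (p n : ℝ) ≤ Real.exp (Cp * n / 2) / 4
  rank : ∀ n, 1 ≤ n → (M n).RankBounds (P n) C
  loadings : (fun n => ⨆ j, specNorm ((M n).Aminus j)) =O[atTop] d₁
  d₁_atTop : Tendsto d₁ atTop atTop
  d₁_small : Tendsto (fun n => d₁ n / Real.sqrt (p n)) atTop (𝓝 0)
  subG : ∀ n, 1 ≤ n → (M n).SubGaussianDesign (P n) C γe γw γf

end HiddenFactor

end

noncomputable section

namespace HiddenFactor

/-! ### Squares of sub-Gaussian variables: exponential moments and Bernstein's inequality. -/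

section Concentration

variable {Ω : Type*} [MeasurableSpace Ω] {μ : Measure Ω}

/-! The diagonal estimator targets `Σ_jj`, not `τ_j²`, so the error splits into noise and bias.

Bias: since `u_j` is independent of `U_{-j}` for every `j`, the noise covariance is diagonal and `Σ
= A'Σ_f A + diag(σ²)`. This forces `σ_j² ≤ τ_j² ≤ Σ_jj = q_j + σ_j²` with `q_j = a_j'Σ_f a_j`
(`tauSq_bounds`), so the bias is at most `q_j`. Bounded loadings give `q_j ≤ C³K`; the
signal-to-noise ratio gives `c ξ̄ q_j ≤ d₂²`. The geometric mean of the two bounds is the first rate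
(`quadForm_le_rate`). The lower bound on `τ_j²` also comes from the sandwich.

Noise: the isotropy and covariance conditions force the factors to be centred, so each `y_{jt}` is
centred and sub-Gaussian with variance proxy of order `K`. Bernstein's inequality for its squares
and a union bound over the `p` outcomes give deviations of order `K √(log p / n)` outside an event
of probability at most `2/p` (`measure_lt_maxErr_le`), which vanishes because `p > n + 1`. -/

lemma integrable_exp_linear_sub_sq {b : ℝ} (hb : 0 < b) (x : ℝ) :
    Integrable fun z : ℝ => Real.exp (x * z - b * z ^ 2) := by
  have h := ((integrable_exp_neg_mul_sq hb).comp_sub_right (x / (2 * b))).const_mul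
    (Real.exp (x ^ 2 / (4 * b)))
  refine h.congr (ae_of_all _ fun z => ?_)
  simp only [← Real.exp_add]
  congr 1
  field_simp
  ring

lemma integral_exp_linear_sub_sq {b : ℝ} (hb : 0 < b) (x : ℝ) :
    ∫ z : ℝ, Real.exp (x * z - b * z ^ 2) = Real.exp (x ^ 2 / (4 * b)) * √(Real.pi / b) := by
  rw [← integral_gaussian, ← integral_const_mul,
    ← integral_sub_right_eq_self (fun z => Real.exp (x ^ 2 / (4 * b)) * Real.exp (-b * z ^ 2))
      (x / (2 * b))]
  congr 1 with z
  rw [← Real.exp_add]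
  congr 1
  field_simp
  ring

/-- Gaussian decoupling: a square-exponential moment of a sub-Gaussian variable. -/
lemma lintegral_exp_sq_le {X : Ω → ℝ} {v : NNReal} [SFinite μ] (hX : HasSubgaussianMGF X v μ)
    (hXm : Measurable X) (hv : 0 < v) :
    ∫⁻ ω, ENNReal.ofReal (Real.exp (X ω ^ 2 / (4 * v))) ∂μ ≤ ENNReal.ofReal √2 := by
  have hv' : (0 : ℝ) < v := hv
  have hs : 0 < √(Real.pi / v) := by positivity
  -- The square in the exponent becomes linear in `X` under an auxiliary integral over `z`. After
  -- Tonelli the inner integral is an mgf, at most `exp (v z² / 2)`, so half of the Gaussian weight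
  -- `exp (-v z²)` survives; halving the weight costs the factor `√2`.
  have key : ∀ ω, ENNReal.ofReal (Real.exp (X ω ^ 2 / (4 * v))) * ENNReal.ofReal √(Real.pi / v) =
      ∫⁻ z : ℝ, ENNReal.ofReal (Real.exp (X ω * z - v * z ^ 2)) := by
    intro ω
    rw [← ENNReal.ofReal_mul (Real.exp_nonneg _), ← integral_exp_linear_sub_sq hv',
      ofReal_integral_eq_lintegral_ofReal (integrable_exp_linear_sub_sq hv' _)
        (ae_of_all _ fun _ => Real.exp_nonneg _)]
  have hne : ENNReal.ofReal √(Real.pi / v) ≠ 0 := by simpa using hs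
  rw [← ENNReal.mul_le_mul_iff_left hne ENNReal.ofReal_ne_top, ← lintegral_mul_const' _ _
    ENNReal.ofReal_ne_top]
  simp_rw [key]
  rw [lintegral_lintegral_swap (by fun_prop)]
  calc ∫⁻ z : ℝ, ∫⁻ ω, ENNReal.ofReal (Real.exp (X ω * z - v * z ^ 2)) ∂μ
      ≤ ∫⁻ z : ℝ, ENNReal.ofReal (Real.exp (-(v / 2) * z ^ 2)) := by
        refine lintegral_mono fun z => ?_
        have h1 : ∀ ω, Real.exp (X ω * z - v * z ^ 2) =
            Real.exp (z * X ω) * Real.exp (-(v * z ^ 2)) := by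
          intro ω
          rw [← Real.exp_add]
          ring_nf
        have hi := (hX.integrable_exp_mul z).mul_const (Real.exp (-(v * z ^ 2)))
        simp only [h1]
        rw [← ofReal_integral_eq_lintegral_ofReal hi (ae_of_all _ fun _ => by positivity),
          integral_mul_const]
        refine ENNReal.ofReal_le_ofReal ?_
        calc _ ≤ Real.exp (v * z ^ 2 / 2) * Real.exp (-(v * z ^ 2)) := by
              gcongr
              exact hX.mgf_le z
          _ = _ := by rw [← Real.exp_add]; ring_nf
    _ = ENNReal.ofReal √(Real.pi / (v / 2)) := by
        rw [← integral_gaussian, ofReal_integral_eq_lintegral_ofReal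
          (integrable_exp_neg_mul_sq (by positivity)) (ae_of_all _ fun _ => Real.exp_nonneg _)]
    _ = _ := by
        rw [← ENNReal.ofReal_mul (by positivity), ← Real.sqrt_mul (by positivity)]
        congr 2
        field_simp

lemma integrable_exp_sq {X : Ω → ℝ} {v : NNReal} [SFinite μ] (hX : HasSubgaussianMGF X v μ)
    (hXm : Measurable X) (hv : 0 < v) :
    Integrable (fun ω => Real.exp (X ω ^ 2 / (4 * v))) μ := by
  refine ⟨by fun_prop, ?_⟩
  rw [hasFiniteIntegral_iff_ofReal (ae_of_all _ fun _ => Real.exp_nonneg _)]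
  exact (lintegral_exp_sq_le hX hXm hv).trans_lt ENNReal.ofReal_lt_top

lemma integral_exp_sq_le {X : Ω → ℝ} {v : NNReal} [SFinite μ] (hX : HasSubgaussianMGF X v μ)
    (hXm : Measurable X) (hv : 0 < v) :
    ∫ ω, Real.exp (X ω ^ 2 / (4 * v)) ∂μ ≤ √2 := by
  have h := lintegral_exp_sq_le hX hXm hv
  rwa [← ofReal_integral_eq_lintegral_ofReal (integrable_exp_sq hX hXm hv)
    (ae_of_all _ fun _ => Real.exp_nonneg _), ENNReal.ofReal_le_ofReal_iff (by positivity)] at h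

/-- Quadratic bound for the exponential, in the form used for sub-exponential variables. -/
lemma exp_le_one_add_add {x w s : ℝ} (hs0 : 0 ≤ s) (hs : s ≤ 1) (hx : |x| ≤ s * w) :
    Real.exp x ≤ 1 + x + 2 * s ^ 2 * Real.exp (2 * w) := by
  -- A negative `w` is compatible with the bound on `|x|` only if `s = 0`, and then `x = 0`.
  have hw : 0 ≤ w ∨ s = 0 := by
    rcases hs0.eq_or_lt with h | h
    · exact Or.inr h.symm
    · left
      by_contra! hw
      nlinarith [abs_nonneg x, mul_neg_of_pos_of_neg h hw]
  rcases hw with hw | rfl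
  swap
  · have : x = 0 := by simpa using hx
    simp [this]
  have h1 : Real.exp x ≤ 1 + x + x ^ 2 * Real.exp |x| := by
    have h := Complex.norm_exp_sub_sum_le_norm_mul_exp (x : ℂ) 2
    simp only [Finset.sum_range_succ, Finset.sum_range_zero] at h
    norm_num at h
    have h' : ‖Complex.exp x - (1 + x)‖ = |Real.exp x - (1 + x)| := by
      rw [← Real.norm_eq_abs, ← Complex.norm_real]
      push_cast
      rfl
    rw [h'] at h
    linarith [le_abs_self (Real.exp x - (1 + x))]
  have h2 : x ^ 2 ≤ s ^ 2 * w ^ 2 := by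
    rw [← mul_pow, ← sq_abs x]
    gcongr
  have h3 : |x| ≤ w := hx.trans (mul_le_of_le_one_left hw hs)
  -- Absorbing `w²` into `exp w` leaves `s²` outside as the only small factor, with an exponential
  -- moment of `w` at a fixed level.
  have h4 : w ^ 2 ≤ 2 * Real.exp w := by
    have := Real.quadratic_le_exp_of_nonneg hw
    linarith
  calc Real.exp x ≤ 1 + x + x ^ 2 * Real.exp |x| := h1
    _ ≤ 1 + x + s ^ 2 * w ^ 2 * Real.exp w := by gcongr
    _ = 1 + x + s ^ 2 * (w ^ 2 * Real.exp w) := by ring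
    _ ≤ 1 + x + s ^ 2 * (2 * Real.exp w * Real.exp w) := by gcongr
    _ = _ := by rw [mul_assoc 2, ← Real.exp_add]; ring_nf

variable [IsProbabilityMeasure μ]

lemma integral_sq_le_of_subgaussian {X : Ω → ℝ} {v : NNReal} (hX : HasSubgaussianMGF X v μ)
    (hXm : Measurable X) (hv : 0 < v) : ∫ ω, X ω ^ 2 ∂μ ≤ 4 * v := by
  have hv' : (0 : ℝ) < v := hv
  have h2 : Integrable (fun ω => X ω ^ 2) μ := (hX.memLp 2).integrable_sq
  have h : ∫ ω, (X ω ^ 2 / (4 * v) + 1) ∂μ ≤ √2 := by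
    refine le_trans (integral_mono ((h2.div_const _).add (integrable_const _))
      (integrable_exp_sq hX hXm hv) fun ω => Real.add_one_le_exp _) (integral_exp_sq_le hX hXm hv)
  rw [integral_add (h2.div_const _) (integrable_const _), integral_div] at h
  simp only [integral_const, probReal_univ, smul_eq_mul, mul_one] at h
  have h3 : √2 ≤ 2 := by rw [Real.sqrt_le_left] <;> norm_num
  have h4 : (∫ ω, X ω ^ 2 ∂μ) / (4 * v) ≤ 1 := by linarith
  rwa [div_le_one (by positivity)] at h4

/-- A pointwise bound whose linear term integrates to zero, leaving an mgf bound quadratic in `l`.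
-/
lemma exp_mul_sq_sub_le {X : Ω → ℝ} {v : NNReal} (hX : HasSubgaussianMGF X v μ)
    (hXm : Measurable X) (hv : 0 < v) {l : ℝ} (hl : 8 * v * |l| ≤ 1) (ω : Ω) :
    Real.exp (l * (X ω ^ 2 - ∫ ω', X ω' ^ 2 ∂μ)) ≤ 1 + l * (X ω ^ 2 - ∫ ω', X ω' ^ 2 ∂μ) +
      2 * (8 * v * |l|) ^ 2 * Real.exp 1 * Real.exp (X ω ^ 2 / (4 * v)) := by
  have hv' : (0 : ℝ) < v := hv
  have hm := integral_sq_le_of_subgaussian hX hXm hv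
  have hm0 : 0 ≤ ∫ ω', X ω' ^ 2 ∂μ := integral_nonneg fun _ => sq_nonneg _
  -- Here `s * w = |l| (X² + 4v)` dominates the exponent because the mean lies in `[0, 4v]`, and
  -- `exp (2w)` is `e` times the exponential moment already controlled.
  refine (exp_le_one_add_add (w := X ω ^ 2 / (8 * v) + 1 / 2) (s := 8 * v * |l|)
    (by positivity) hl ?_).trans_eq ?_
  · rw [abs_mul]
    have : |X ω ^ 2 - ∫ ω', X ω' ^ 2 ∂μ| ≤ X ω ^ 2 + 4 * v := by
      rw [abs_le]
      constructor <;> nlinarith [sq_nonneg (X ω)]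
    calc |l| * |X ω ^ 2 - ∫ ω', X ω' ^ 2 ∂μ| ≤ |l| * (X ω ^ 2 + 4 * v) := by gcongr
      _ = _ := by field_simp; ring
  · rw [mul_assoc _ (Real.exp 1), ← Real.exp_add]
    congr 2
    rw [Real.exp_eq_exp]
    field_simp
    ring

lemma integrable_exp_mul_sq_sub {X : Ω → ℝ} {v : NNReal} (hX : HasSubgaussianMGF X v μ)
    (hXm : Measurable X) (hv : 0 < v) {l : ℝ} (hl : 8 * v * |l| ≤ 1) :
    Integrable (fun ω => Real.exp (l * (X ω ^ 2 - ∫ ω', X ω' ^ 2 ∂μ))) μ := by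
  have h2 : Integrable (fun ω => X ω ^ 2) μ := (hX.memLp 2).integrable_sq
  have h0 : Integrable (fun ω => l * (X ω ^ 2 - ∫ ω', X ω' ^ 2 ∂μ)) μ :=
    (h2.sub (integrable_const _)).const_mul l
  refine Integrable.mono' (((integrable_const (1 : ℝ)).add h0).add
    ((integrable_exp_sq hX hXm hv).const_mul (2 * (8 * v * |l|) ^ 2 * Real.exp 1))) (by fun_prop) (ae_of_all _ fun ω => ?_)
  rw [Real.norm_eq_abs, Real.abs_exp]
  exact exp_mul_sq_sub_le hX hXm hv hl ω

/-- The centred square of a sub-Gaussian variable is sub-exponential. -/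
lemma mgf_sq_sub_le {X : Ω → ℝ} {v : NNReal} (hX : HasSubgaussianMGF X v μ)
    (hXm : Measurable X) (hv : 0 < v) {l : ℝ} (hl : 8 * v * |l| ≤ 1) :
    mgf (fun ω => X ω ^ 2 - ∫ ω', X ω' ^ 2 ∂μ) μ l ≤ Real.exp (512 * v ^ 2 * l ^ 2) := by
  have h2 : Integrable (fun ω => X ω ^ 2) μ := (hX.memLp 2).integrable_sq
  have h0 : Integrable (fun ω => l * (X ω ^ 2 - ∫ ω', X ω' ^ 2 ∂μ)) μ :=
    (h2.sub (integrable_const _)).const_mul l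
  have h3 := (integrable_const (1 : ℝ)).add h0
  have h4 := (integrable_exp_sq hX hXm hv).const_mul (2 * (8 * v * |l|) ^ 2 * Real.exp 1)
  have h := integral_mono (integrable_exp_mul_sq_sub hX hXm hv hl) (h3.add h4)
    (exp_mul_sq_sub_le hX hXm hv hl)
  have h5 : ∫ ω, (1 + l * (X ω ^ 2 - ∫ ω', X ω' ^ 2 ∂μ)) ∂μ = 1 := by
    rw [integral_add (integrable_const _) h0,
      integral_const_mul, integral_sub h2 (integrable_const _)]
    simp
  have h6 := integral_add h3 h4
  simp only [Pi.add_apply] at h6 h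
  rw [h6, h5, integral_const_mul] at h
  refine h.trans ((add_le_add_right (mul_le_mul_of_nonneg_left
    (integral_exp_sq_le hX hXm hv) (by positivity)) 1).trans ?_)
  have h7 : √2 ≤ 1.42 := by rw [Real.sqrt_le_left] <;> norm_num
  -- This yields the constant `512 = 2 * 8² * 4`.
  have h8 : Real.exp 1 * √2 ≤ 4 := by
    calc Real.exp 1 * √2 ≤ 2.7182818286 * 1.42 := by
          gcongr
          exact Real.exp_one_lt_d9.le
      _ ≤ 4 := by norm_num
  calc 1 + 2 * (8 * v * |l|) ^ 2 * Real.exp 1 * √2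
      = 1 + 128 * v ^ 2 * l ^ 2 * (Real.exp 1 * √2) := by rw [mul_pow _ |l|, sq_abs]; ring
    _ ≤ 1 + 128 * v ^ 2 * l ^ 2 * 4 := by gcongr
    _ = 512 * v ^ 2 * l ^ 2 + 1 := by ring
    _ ≤ _ := Real.add_one_le_exp _

/-- Bernstein bound for the sum of squares of independent sub-Gaussian variables. -/
lemma measureReal_sum_sq_ge_le {n : ℕ} {X : Fin n → Ω → ℝ} {v : NNReal} {m : ℝ}
    (hind : iIndepFun X μ) (hX : ∀ t, HasSubgaussianMGF (X t) v μ) (hXm : ∀ t, Measurable (X t))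
    (hm : ∀ t, ∫ ω, X t ω ^ 2 ∂μ = m) (hv : 0 < v) {θ ε : ℝ} (hθ0 : 0 ≤ θ) (hθ : 8 * θ ≤ 1) :
    μ.real {ω | n * v * ε ≤ |∑ t, (X t ω ^ 2 - m)|} ≤
      2 * Real.exp (-(n * (θ * ε - 512 * θ ^ 2))) := by
  have hv' : (0 : ℝ) < v := hv
  set Z : Fin n → Ω → ℝ := fun t ω => X t ω ^ 2 - m with hZ
  have hZi : iIndepFun Z μ := hind.comp (fun _ x => x ^ 2 - m) fun _ => by fun_prop
  have hZm : ∀ t, Measurable (Z t) := fun t => by fun_prop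
  have hmgf : ∀ l : ℝ, 8 * v * |l| ≤ 1 →
      mgf (∑ t, Z t) μ l ≤ Real.exp (n * (512 * v ^ 2 * l ^ 2)) := by
    intro l hl
    rw [hZi.mgf_sum hZm]
    calc ∏ t, mgf (Z t) μ l ≤ ∏ _t : Fin n, Real.exp (512 * v ^ 2 * l ^ 2) := by
          refine Finset.prod_le_prod (fun _ _ => mgf_nonneg) fun t _ => ?_
          simpa only [hm] using mgf_sq_sub_le (hX t) (hXm t) hv hl
      _ = _ := by simp [← Real.exp_nat_mul]
  have hint : ∀ l : ℝ, 8 * v * |l| ≤ 1 → Integrable (fun ω => Real.exp (l * (∑ t, Z t) ω)) μ := by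
    intro l hl
    refine hZi.integrable_exp_mul_sum hZm fun t _ => ?_
    simpa only [hm] using integrable_exp_mul_sq_sub (hX t) (hXm t) hv hl
  have habs : |θ / v| = θ / v := abs_of_nonneg (by positivity)
  -- The Chernoff parameter is `l = θ / v`: in units of `1 / v` the proxy cancels from the exponent.
  have hl1 : 8 * v * |θ / v| ≤ 1 := by
    rw [habs]
    calc 8 * v * (θ / v) = 8 * θ := by field_simp
      _ ≤ 1 := hθ
  have hl2 : 8 * v * |-(θ / v)| ≤ 1 := by rwa [abs_neg]
  have hsub : {ω | n * v * ε ≤ |∑ t, (X t ω ^ 2 - m)|} ⊆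
      {ω | n * v * ε ≤ (∑ t, Z t) ω} ∪ {ω | (∑ t, Z t) ω ≤ -(n * v * ε)} := by
    intro ω hω
    simp only [Set.mem_ofPred_eq, Set.mem_union, Finset.sum_apply, hZ] at hω ⊢
    rcases le_abs.1 hω with h | h
    · exact Or.inl h
    · exact Or.inr (by linarith)
  refine (measureReal_mono hsub).trans ((measureReal_union_le _ _).trans ?_)
  have e1 := measure_ge_le_exp_mul_mgf (X := ∑ t, Z t) (μ := μ) (n * v * ε)
    (t := θ / v) (by positivity) (hint _ hl1)
  have e2 := measure_le_le_exp_mul_mgf (X := ∑ t, Z t) (μ := μ) (-(n * v * ε))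
    (t := -(θ / v)) (by rw [neg_nonpos]; positivity) (hint _ hl2)
  have b1 : Real.exp (-(θ / v) * (n * v * ε)) * Real.exp (n * (512 * v ^ 2 * (θ / v) ^ 2)) =
      Real.exp (-(n * (θ * ε - 512 * θ ^ 2))) := by
    rw [← Real.exp_add]
    congr 1
    field_simp
    ring
  have c1 := e1.trans (mul_le_mul_of_nonneg_left (hmgf _ hl1) (Real.exp_nonneg _))
  have c2 := e2.trans (mul_le_mul_of_nonneg_left (hmgf _ hl2) (Real.exp_nonneg _))
  rw [b1] at c1
  rw [neg_sq, neg_neg, mul_neg, ← neg_mul (θ / v), b1] at c2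
  linarith

end Concentration

/-! ### Eigenvalue bounds and diagonal entries of an inverse. -/

section MatrixLemmas

open Matrix

variable {m k : Type*} [Fintype m] [DecidableEq m] [Fintype k] [DecidableEq k]

lemma sum_sq_eigenvectorBasis_dotProduct {M : Matrix m m ℝ} (hM : M.IsHermitian) (x : m → ℝ) :
    ∑ i, ((hM.eigenvectorBasis i).ofLp ⬝ᵥ x) ^ 2 = x ⬝ᵥ x := by
  have h := hM.eigenvectorBasis.sum_inner_mul_inner (WithLp.toLp 2 x) (WithLp.toLp 2 x)
  simp only [EuclideanSpace.inner_eq_star_dotProduct, star_trivial] at h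
  rw [← h]
  refine Finset.sum_congr rfl fun i _ => ?_
  rw [dotProduct_comm x, sq]

lemma sum_eigenvalues_mul_sq {M : Matrix m m ℝ} (hM : M.IsHermitian) (x : m → ℝ) :
    ∑ i, hM.eigenvalues i * ((hM.eigenvectorBasis i).ofLp ⬝ᵥ x) ^ 2 = x ⬝ᵥ M *ᵥ x := by
  have h := hM.eigenvectorBasis.sum_inner_mul_inner (WithLp.toLp 2 x) (WithLp.toLp 2 (M *ᵥ x))
  simp only [EuclideanSpace.inner_eq_star_dotProduct, star_trivial] at h
  rw [dotProduct_comm x, ← h]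
  refine Finset.sum_congr rfl fun i _ => ?_
  have hT : Mᵀ = M := (conjTranspose_eq_transpose_of_trivial M).symm.trans hM.eq
  have h1 : (M *ᵥ x) ⬝ᵥ (hM.eigenvectorBasis i).ofLp =
      hM.eigenvalues i * ((hM.eigenvectorBasis i).ofLp ⬝ᵥ x) := by
    rw [dotProduct_comm, dotProduct_mulVec, ← mulVec_transpose, hT, hM.mulVec_eigenvectorBasis,
      smul_dotProduct, smul_eq_mul]
  rw [h1]
  ring

lemma dotProduct_mulVec_le_eigMax {M : Matrix m m ℝ} (hM : M.IsHermitian)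
    (hm : 1 ≤ Fintype.card m) (x : m → ℝ) : x ⬝ᵥ M *ᵥ x ≤ eigMax M * (x ⬝ᵥ x) := by
  rw [← sum_sq_eigenvectorBasis_dotProduct hM, ← sum_eigenvalues_mul_sq hM, Finset.mul_sum]
  refine Finset.sum_le_sum fun i _ => mul_le_mul_of_nonneg_right ?_ (sq_nonneg _)
  rw [eigMax, kthEig, dif_pos ⟨hM, le_rfl, hm⟩]
  exact hM.eigenvalues₀_antitone (Fin.mk_le_of_le_val (Nat.zero_le _))

/-- For a positive semidefinite matrix of rank `r`, the `r`-th eigenvalue is positive and separates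
the nonzero eigenvalues from `0`. -/
lemma kthEig_rank_pos {M : Matrix m m ℝ} (hM : M.PosSemidef) {r : ℕ} (hr : M.rank = r)
    (hr1 : 1 ≤ r) :
    0 < kthEig M r ∧ ∀ i, hM.1.eigenvalues i = 0 ∨ kthEig M r ≤ hM.1.eigenvalues i := by
  have hrm : r ≤ Fintype.card m := hr ▸ M.rank_le_card_width
  rw [kthEig, dif_pos ⟨hM.1, hr1, hrm⟩]
  -- The reindexing built into `eigenvalues`, so that `hev` is definitional. Positions are
  -- zero-based: the `r`-th eigenvalue sits at `r - 1`.
  set e := Fintype.equivOfCardEq (Fintype.card_fin (Fintype.card m)) with he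
  have hev : ∀ i, hM.1.eigenvalues i = hM.1.eigenvalues₀ (e.symm i) := fun _ => rfl
  have hanti := hM.1.eigenvalues₀_antitone
  have hnn : ∀ i, 0 ≤ hM.1.eigenvalues₀ i := fun i => by
    simpa [hev] using hM.eigenvalues_nonneg (e i)
  have hcard : (Finset.univ.filter fun i => hM.1.eigenvalues₀ i ≠ 0).card = r := by
    rw [← hr, hM.1.rank_eq_card_non_zero_eigs, Fintype.card_subtype]
    refine Finset.card_bij (fun i _ => e i) ?_ ?_ ?_
    · intro i hi
      simpa [hev] using hi
    · intro i _ j _ h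
      exact e.injective h
    · intro i hi
      exact ⟨e.symm i, by simpa [hev] using hi, by simp⟩
  constructor
  · by_contra h
    have h0 : hM.1.eigenvalues₀ ⟨r - 1, by omega⟩ = 0 := le_antisymm (not_lt.1 h) (hnn _)
    -- Otherwise all nonzero eigenvalues would lie in the first `r - 1` positions, but there are `r`
    -- of them.
    have hsub : (Finset.univ.filter fun i => hM.1.eigenvalues₀ i ≠ 0) ⊆
        Finset.Iio ⟨r - 1, by omega⟩ := by
      intro i hi
      rw [Finset.mem_Iio]
      by_contra hle
      exact (Finset.mem_filter.1 hi).2 (le_antisymm ((hanti (not_lt.1 hle)).trans h0.le) (hnn i))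
    have := Finset.card_le_card hsub
    rw [hcard, Fin.card_Iio] at this
    simp only at this
    omega
  · intro i
    by_cases hi : (e.symm i : ℕ) < r
    · right
      exact hanti (Fin.le_def.2 (Nat.le_sub_one_of_lt hi))
    · left
      by_contra hne
      -- A nonzero eigenvalue at position `r` or later would make at least `r + 1` eigenvalues
      -- nonzero.
      have hsub : Finset.Iic (e.symm i) ⊆
          (Finset.univ.filter fun i => hM.1.eigenvalues₀ i ≠ 0) := by
        intro j hj
        rw [Finset.mem_filter]
        have h1 := hanti (Finset.mem_Iic.1 hj)
        have h2 : 0 < hM.1.eigenvalues₀ (e.symm i) := lt_of_le_of_ne (hnn _) (Ne.symm hne)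
        exact ⟨Finset.mem_univ _, (h2.trans_le h1).ne'⟩
      have := Finset.card_le_card hsub
      rw [hcard, Fin.card_Iic] at this
      omega

lemma isUnit_of_rank_eq_card {A : Matrix k k ℝ} (hA : A.rank = Fintype.card k) : IsUnit A := by
  rw [← mulVec_surjective_iff_isUnit]
  have h : LinearMap.range A.mulVecLin = ⊤ := by
    apply Submodule.eq_top_of_finrank_eq
    rw [Module.finrank_fintype_fun_eq_card, ← hA, Matrix.rank]
  exact LinearMap.range_eq_top.1 h

lemma dotProduct_mulVec_mul_transpose {m k : Type*} [Fintype m] [Fintype k] (B : Matrix m k ℝ) (x : m → ℝ) :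
    x ⬝ᵥ (B * Bᵀ) *ᵥ x = (Bᵀ *ᵥ x) ⬝ᵥ (Bᵀ *ᵥ x) := by
  rw [← mulVec_mulVec, dotProduct_mulVec, ← mulVec_transpose]

/-- If `B` has full column rank, the `K`-th eigenvalue of `B B'` bounds `B'B` from below. -/
lemma kthEig_mul_dotProduct_le {B : Matrix m k ℝ} (hB : B.rank = Fintype.card k)
    (hk : 1 ≤ Fintype.card k) :
    0 < kthEig (B * Bᵀ) (Fintype.card k) ∧
      ∀ w, kthEig (B * Bᵀ) (Fintype.card k) * (w ⬝ᵥ w) ≤ (B *ᵥ w) ⬝ᵥ (B *ᵥ w) := by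
  have hM : (B * Bᵀ).PosSemidef := by simpa using posSemidef_self_mul_conjTranspose B
  obtain ⟨hpos, hev⟩ := kthEig_rank_pos hM (by rw [rank_self_mul_transpose, hB]) hk
  refine ⟨hpos, fun w => ?_⟩
  set l := kthEig (B * Bᵀ) (Fintype.card k)
  -- Null eigenvectors of `B B'` are orthogonal to the range of `B`, so only eigenvalues at least
  -- `l` contribute there.
  have hrange : ∀ z, l * ((B *ᵥ z) ⬝ᵥ (B *ᵥ z)) ≤ (Bᵀ *ᵥ B *ᵥ z) ⬝ᵥ (Bᵀ *ᵥ B *ᵥ z) := by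
    intro z
    rw [← dotProduct_mulVec_mul_transpose, ← sum_sq_eigenvectorBasis_dotProduct hM.1,
      ← sum_eigenvalues_mul_sq hM.1, Finset.mul_sum]
    refine Finset.sum_le_sum fun i _ => ?_
    rcases hev i with h | h
    · have h1 : (Bᵀ *ᵥ (hM.1.eigenvectorBasis i).ofLp) = 0 := by
        rw [← dotProduct_self_eq_zero, ← dotProduct_mulVec_mul_transpose,
          hM.1.mulVec_eigenvectorBasis, h, zero_smul, dotProduct_zero]
      rw [dotProduct_mulVec, ← mulVec_transpose, h1]
      simp
    · exact mul_le_mul_of_nonneg_right h (sq_nonneg _)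
  have hG : IsUnit (Bᵀ * B) :=
    isUnit_of_rank_eq_card (by rw [rank_transpose_mul_self, hB])
  -- With `w = B'Bz`, `hrange` gives `l |Bz|² ≤ |w|²`, and Cauchy–Schwarz applied to `|w|² = ⟨Bz,
  -- Bw⟩` turns this into `l |w|⁴ ≤ |w|² |Bw|²`.
  obtain ⟨z, hz⟩ : ∃ z, Bᵀ *ᵥ B *ᵥ z = w := by
    refine ⟨(Bᵀ * B)⁻¹ *ᵥ w, ?_⟩
    rw [mulVec_mulVec, mulVec_mulVec, Matrix.mul_nonsing_inv _ ((isUnit_iff_isUnit_det _).1 hG),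
      one_mulVec]
  have h1 := hrange z
  rw [hz] at h1
  have h2 : w ⬝ᵥ w = (B *ᵥ z) ⬝ᵥ (B *ᵥ w) := by
    nth_rewrite 1 [← hz]
    rw [dotProduct_mulVec (B *ᵥ z), ← mulVec_transpose]
  have hcs : (w ⬝ᵥ w) ^ 2 ≤ ((B *ᵥ z) ⬝ᵥ (B *ᵥ z)) * ((B *ᵥ w) ⬝ᵥ (B *ᵥ w)) := by
    rw [h2]
    simpa [dotProduct, sq] using
      Finset.sum_mul_sq_le_sq_mul_sq Finset.univ (B *ᵥ z) (B *ᵥ w)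
  have hw0 : 0 ≤ w ⬝ᵥ w := by simpa using dotProduct_star_self_nonneg w
  have hb0 : 0 ≤ (B *ᵥ w) ⬝ᵥ (B *ᵥ w) := by simpa using dotProduct_star_self_nonneg (B *ᵥ w)
  rcases hw0.eq_or_lt with h | h
  · rw [← h]
    simpa using hb0
  · refine le_of_mul_le_mul_right ?_ h
    nlinarith

lemma le_specNorm_diag (M : Matrix m m ℝ) (i : m) : M i i ≤ specNorm M := by
  have h := l2_opNorm_mulVec M (EuclideanSpace.single i 1)
  rw [PiLp.norm_single, norm_one, mul_one] at h
  refine le_trans ?_ h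
  refine le_trans ?_ (PiLp.norm_apply_le _ i)
  simp [le_abs_self]

/-- Two-sided bound for the reciprocal diagonal entries of the inverse of `G + diag s`. -/
lemma one_div_inv_diag_bounds {G : Matrix m m ℝ} {s : m → ℝ} (hG : G.PosSemidef)
    (hs : ∀ i, 0 < s i) (j : m) :
    s j ≤ 1 / (G + diagonal s)⁻¹ j j ∧ 1 / (G + diagonal s)⁻¹ j j ≤ (G + diagonal s) j j := by
  have hD : (diagonal s).PosDef := PosDef.diagonal hs
  have hS : (G + diagonal s).PosDef := hD.posSemidef_add hG
  set S := G + diagonal s with hSdef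
  have hpos : 0 < S⁻¹ j j := hS.inv.diag_pos
  have hSpos : 0 < S j j := hS.diag_pos
  have hdet : IsUnit S.det := (isUnit_iff_isUnit_det _).1 hS.isUnit
  -- For this column `x'Sx = x_j = (S⁻¹)_jj`. Dropping all of `x'Sx` except `s_j x_j²` gives the
  -- lower bound.
  set x : m → ℝ := S⁻¹ *ᵥ Pi.single j 1 with hx
  have hxj : x j = S⁻¹ j j := by simp [hx]
  have hSx : S *ᵥ x = Pi.single j 1 := by
    rw [hx, mulVec_mulVec, mul_nonsing_inv _ hdet, one_mulVec]
  have hxSx : x ⬝ᵥ S *ᵥ x = x j := by simp [hSx]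
  constructor
  · rw [le_div_iff₀ hpos, ← hxj]
    have h1 : x ⬝ᵥ S *ᵥ x = x ⬝ᵥ G *ᵥ x + ∑ i, s i * x i ^ 2 := by
      rw [hSdef, add_mulVec, dotProduct_add]
      congr 1
      simp only [dotProduct, mulVec_diagonal]
      exact Finset.sum_congr rfl fun i _ => by ring
    have h2 : 0 ≤ x ⬝ᵥ G *ᵥ x := by simpa using hG.dotProduct_mulVec_nonneg x
    have h3 : s j * x j ^ 2 ≤ ∑ i, s i * x i ^ 2 :=
      Finset.single_le_sum (f := fun i => s i * x i ^ 2)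
        (fun i _ => mul_nonneg (hs i).le (sq_nonneg _)) (Finset.mem_univ j)
    have hxpos : 0 < x j := hxj ▸ hpos
    refine le_of_mul_le_mul_right ?_ hxpos
    linarith
  -- The form at this vector equals `(S⁻¹)_jj - 1 / S_jj`.
  · have h := hS.posSemidef.dotProduct_mulVec_nonneg (x - (1 / S j j) • Pi.single j 1)
    have e1 : (Pi.single j 1 : m → ℝ) ⬝ᵥ S *ᵥ Pi.single j 1 = S j j := by simp
    have e2 : x ⬝ᵥ S *ᵥ Pi.single j 1 = 1 := by
      have hT : Sᵀ = S := (conjTranspose_eq_transpose_of_trivial S).symm.trans hS.1.eq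
      rw [dotProduct_mulVec, ← mulVec_transpose, hT, hSx]
      simp
    have e3 : (Pi.single j 1 : m → ℝ) ⬝ᵥ S *ᵥ x = 1 := by simp [hSx]
    rw [star_trivial, mulVec_sub, mulVec_smul, sub_dotProduct, dotProduct_sub, dotProduct_sub,
      smul_dotProduct, smul_dotProduct, dotProduct_smul, dotProduct_smul, hxSx, e1, e2, e3] at h
    simp only [smul_eq_mul, mul_one] at h
    rw [one_div_mul_cancel hSpos.ne', mul_one, sub_self, sub_zero, sub_nonneg, hxj] at h
    rw [one_div_le hpos hSpos]
    exact h

end MatrixLemmas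

/-! ### Covariance matrices and sub-Gaussian vectors. -/

section CovarianceMatrices

open Matrix

variable {Ω ι κ : Type*} [MeasurableSpace Ω] {P : Measure Ω}

lemma hasSubgaussianMGF_mono {X : Ω → ℝ} {a b : NNReal} (hX : HasSubgaussianMGF X a P)
    (hab : a ≤ b) : HasSubgaussianMGF X b P where
  integrable_exp_mul := hX.integrable_exp_mul
  mgf_le t := (hX.mgf_le t).trans (by gcongr)

lemma memLp_dotProduct [Fintype ι] {X : Ω → ι → ℝ} (hX : ∀ i, MemLp (fun ω => X ω i) 2 P)
    (w : ι → ℝ) : MemLp (fun ω => w ⬝ᵥ X ω) 2 P :=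
  memLp_finsetSum _ fun i _ => (hX i).const_mul (w i)

variable [IsProbabilityMeasure P]

lemma covariance_dotProduct [Fintype ι] {X : Ω → ι → ℝ}
    (hX : ∀ i, MemLp (fun ω => X ω i) 2 P) (v w : ι → ℝ) :
    covariance (fun ω => v ⬝ᵥ X ω) (fun ω => w ⬝ᵥ X ω) P = v ⬝ᵥ covMat P X *ᵥ w := by
  simp only [dotProduct, mulVec, covMat, of_apply]
  rw [covariance_fun_sum_fun_sum (fun i => (hX i).const_mul (v i))
    (fun i => (hX i).const_mul (w i))]
  refine Finset.sum_congr rfl fun i _ => ?_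
  rw [Finset.mul_sum]
  refine Finset.sum_congr rfl fun j _ => ?_
  rw [covariance_const_mul_left, covariance_const_mul_right]
  ring

lemma mul_mul_apply_eq_dotProduct [Fintype ι] (A : Matrix κ ι ℝ) (B : Matrix ι ι ℝ)
    (D : Matrix ι κ ℝ) (i j : κ) : (A * B * D) i j = A.row i ⬝ᵥ B *ᵥ D.col j := by
  rw [Matrix.mul_assoc]
  rfl

lemma covMat_mulVec [Fintype ι] {X : Ω → ι → ℝ}
    (hX : ∀ i, MemLp (fun ω => X ω i) 2 P) (S : Matrix κ ι ℝ) :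
    covMat P (fun ω => S *ᵥ X ω) = S * covMat P X * Sᵀ := by
  ext i j
  rw [mul_mul_apply_eq_dotProduct, col_transpose, ← covariance_dotProduct hX]
  rfl

/-- Linear functionals of a sub-Gaussian vector. -/
lemma IsSubGVec.hasSubgaussianMGF_dotProduct [Fintype ι] {γ : ℝ} {X : Ω → ι → ℝ}
    (hX : IsSubGVec P γ X) (w : ι → ℝ) :
    HasSubgaussianMGF (fun ω => w ⬝ᵥ X ω) (Real.toNNReal (γ ^ 2 * (w ⬝ᵥ w))) P := by
  have hnn : 0 ≤ w ⬝ᵥ w := by simpa using dotProduct_star_self_nonneg w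
  by_cases hw : w = 0
  · subst hw
    simp
  · have hpos : 0 < eucNorm w := by
      rw [eucNorm, norm_pos_iff]
      exact fun h => hw (by simpa using h)
    have hsq : eucNorm w ^ 2 = w ⬝ᵥ w := by
      rw [eucNorm, EuclideanSpace.real_norm_sq_eq]
      simp [dotProduct, sq]
    have hu : eucNorm ((eucNorm w)⁻¹ • w) = 1 := by
      rw [eucNorm, WithLp.toLp_smul, norm_smul, norm_inv, Real.norm_eq_abs, abs_of_pos hpos]
      exact inv_mul_cancel₀ hpos.ne'
    have h := (hX _ hu).const_mul (eucNorm w)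
    have e1 : (fun ω => eucNorm w * ((eucNorm w)⁻¹ • w) ⬝ᵥ X ω) = fun ω => w ⬝ᵥ X ω := by
      ext ω
      rw [smul_dotProduct, smul_eq_mul, mul_inv_cancel_left₀ hpos.ne']
    rw [e1] at h
    convert h using 1
    ext
    rw [Real.coe_toNNReal _ (by positivity), ← hsq, mul_comm]
    exact congrArg (eucNorm w ^ 2 * ·) (Real.coe_toNNReal _ (sq_nonneg γ)).symm

lemma memLp_of_isSubGVec_sub [Fintype ι] [DecidableEq ι] {γ : ℝ} {X : Ω → ι → ℝ} {m : ι → ℝ}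
    (hX : IsSubGVec P γ (fun ω k => X ω k - m k)) (i : ι) : MemLp (fun ω => X ω i) 2 P := by
  have h := ((hX.hasSubgaussianMGF_dotProduct (Pi.single i 1)).memLp 2).add (memLp_const (m i))
  refine h.ae_eq (ae_of_all _ fun ω => ?_)
  simp

/-- An isotropic vector whose image under an invertible matrix `S` has covariance `S S'` is
centred. -/
lemma integral_eq_zero_of_isotropic [Fintype ι] [DecidableEq ι] {X : Ω → ι → ℝ}
    (hX : ∀ i, MemLp (fun ω => X ω i) 2 P) (hiso : IsotropicVec P X) {S : Matrix ι ι ℝ}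
    (hS : IsUnit S) (hcov : covMat P (fun ω => S *ᵥ X ω) = S * Sᵀ) (i : ι) :
    ∫ ω, X ω i ∂P = 0 := by
  have hd : IsUnit S.det := (isUnit_iff_isUnit_det _).1 hS
  have hd' : IsUnit Sᵀ.det := by rwa [det_transpose]
  rw [covMat_mulVec hX] at hcov
  -- Cancelling `S` makes the covariance the identity; the second moments are also the identity, so
  -- the squared means, their difference on the diagonal, vanish.
  have h1 : covMat P X = 1 := by
    have h2 : S⁻¹ * (S * covMat P X * Sᵀ) * Sᵀ⁻¹ = S⁻¹ * (S * Sᵀ) * Sᵀ⁻¹ := by rw [hcov]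
    rwa [mul_assoc S, nonsing_inv_mul_cancel_left _ _ hd, mul_nonsing_inv_cancel_right _ _ hd',
      nonsing_inv_mul_cancel_left _ _ hd, mul_nonsing_inv _ hd'] at h2
  have h3 := congrFun (congrFun h1 i) i
  rw [covMat, of_apply, one_apply_eq, covariance_eq_sub (hX i) (hX i)] at h3
  have h4 := hiso i i
  rw [if_pos rfl] at h4
  simp only [Pi.mul_apply, h4] at h3
  have h5 : (∫ ω, X ω i ∂P) * (∫ ω, X ω i ∂P) = 0 := by linarith
  simpa using h5

end CovarianceMatrices

/-! ### The factor model: structure of `Σ`, bias, and concentration. -/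

namespace FactorModel

open Matrix

variable {Ω : Type*} [MeasurableSpace Ω] {P : Measure Ω} {n p K : ℕ}
  {M : FactorModel Ω n p K} {c C γe γw γf : ℝ}

lemma indepFun_f_u (hS : M.Sampling P) (t : Fin n) (j : Fin p) :
    IndepFun (M.f t) (fun ω => M.u t ω j) P :=
  (IndepFun_iff_Indep _ _ _).2 ((hS.indep t j).indep (i := 0) (j := 1) (by decide))

lemma indepFun_u_u (hS : M.Sampling P) (t : Fin n) {i j : Fin p} (hij : i ≠ j) :
    IndepFun (fun ω => M.u t ω i) (fun ω => M.u t ω j) P := by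
  have h : IndepFun (fun ω => M.u t ω j) (M.uMinus j t) P :=
    (IndepFun_iff_Indep _ _ _).2 ((hS.indep t j).indep (i := 1) (j := 2) (by decide))
  exact (h.comp measurable_id (measurable_pi_apply (⟨i, hij⟩ : {i : Fin p // i ≠ j}))).symm

lemma measurable_y (hS : M.Sampling P) (t : Fin n) : Measurable (M.y t) := by
  have hf := hS.measurable_f t
  have hu := hS.measurable_u t
  refine measurable_pi_lambda _ fun j => ?_
  simp only [y, dotProduct]
  fun_prop

lemma memLp_u (hD : M.SubGaussianDesign P C γe γw γf) (t : Fin n) (j : Fin p) :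
    MemLp (fun ω => M.u t ω j) 2 P :=
  (hD.subG_u t j).memLp 2

lemma y_eq {Ω : Type*} {n p K : ℕ} {M : FactorModel Ω n p K} (t : Fin n) (j : Fin p) :
    (fun ω => M.y t ω j) = (fun ω => M.a j ⬝ᵥ M.f t ω) + fun ω => M.u t ω j := by
  ext ω
  exact congrArg (· + M.u t ω j) (dotProduct_comm _ _)

lemma posSemidef_SigmaF (hD : M.SubGaussianDesign P C γe γw γf) : (M.SigmaF P).PosSemidef := by
  obtain ⟨S, ⟨hS, hSS⟩, -⟩ := hD.subG_f
  have h := posSemidef_self_mul_conjTranspose S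
  rwa [hS.1.eq, hSS] at h

/-- Every diagonal entry of `Σ_{U,-j}` is some `σ_i²` with `i ≠ j`, and the spectral norm dominates
diagonal entries. -/
lemma c_le_specNorm (hn : 0 < n) (hN : M.NoiseBounds P c C) (hp : 1 < p) (j : Fin p) :
    c ≤ specNorm (M.SigmaUminus P j) := by
  obtain ⟨i, hi⟩ : ∃ i : Fin p, i ≠ j := by
    have : Nontrivial (Fin p) := Fin.nontrivial_iff_two_le.2 hp
    exact exists_ne j
  refine (hN.sigmaSq_ge i).trans (le_trans (le_of_eq ?_) (le_specNorm_diag _ ⟨i, hi⟩))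
  simp only [sigmaSq, SigmaUminus, rowCov, dif_pos hn]
  rfl

/-- The quadratic forms `a_j' Σ_f a_j` are of order `K`. -/
lemma quadForm_le (hR : M.RankBounds P C) (hD : M.SubGaussianDesign P C γe γw γf) (hC : 0 < C)
    (hK : 1 ≤ K) (j : Fin p) : M.a j ⬝ᵥ M.SigmaF P *ᵥ M.a j ≤ C ^ 3 * K := by
  have h1 := dotProduct_mulVec_le_eigMax (posSemidef_SigmaF hD).1 (by simpa using hK) (M.a j)
  have h2 : M.a j ⬝ᵥ M.a j ≤ K * C ^ 2 := by
    have : ∀ k ∈ Finset.univ, M.a j k * M.a j k ≤ C ^ 2 := fun k _ => by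
      rw [← sq]
      exact sq_le_sq' (abs_le.1 (hD.bdd_A k j)).1 (abs_le.1 (hD.bdd_A k j)).2
    simpa [dotProduct] using Finset.sum_le_card_nsmul _ _ _ this
  have h0 : 0 ≤ M.a j ⬝ᵥ M.a j := by simpa using dotProduct_star_self_nonneg (M.a j)
  calc _ ≤ eigMax (M.SigmaF P) * (M.a j ⬝ᵥ M.a j) := h1
    _ ≤ C * (K * C ^ 2) := mul_le_mul hR.eigMax_F h2 h0 hC.le
    _ = _ := by ring

/-- The signal-to-noise ratio is positive and controls `a_j' Σ_f a_j` through `d₂`. -/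
lemma quadForm_mul_xiBar_le (hn : 0 < n) (hN : M.NoiseBounds P c C) (hR : M.RankBounds P C)
    (hD : M.SubGaussianDesign P C γe γw γf) (hc : 0 < c) (hK : 1 ≤ K) :
    0 < M.xiBar P ∧ 0 ≤ M.d2 P ∧
      ∀ j, c * M.xiBar P * (M.a j ⬝ᵥ M.SigmaF P *ᵥ M.a j) ≤ M.d2 P ^ 2 := by
  have hp : 1 < p := by have := hR.dim; omega
  have : Nonempty (Fin p) := ⟨⟨0, by omega⟩⟩
  obtain ⟨S, ⟨hS, hSS⟩, -⟩ := hD.subG_f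
  have hST : Sᵀ = S := (conjTranspose_eq_transpose_of_trivial S).symm.trans hS.1.eq
  have hFu : IsUnit (M.SigmaF P) := isUnit_of_rank_eq_card (by simpa using hR.rank_F)
  have hSd : IsUnit S.det := by
    have h := (isUnit_iff_isUnit_det _).1 hFu
    rw [← hSS, det_mul] at h
    exact isUnit_of_mul_isUnit_left h
  have hspec := c_le_specNorm hn hN hp
  have hkey : ∀ j, 0 < kthEig (M.Aminus j * M.SigmaF P * (M.Aminus j).transpose) K ∧
      kthEig (M.Aminus j * M.SigmaF P * (M.Aminus j).transpose) K *
        (M.a j ⬝ᵥ M.SigmaF P *ᵥ M.a j) ≤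
        eucNorm (Matrix.vecMul (M.a j) (M.SigmaF P * (M.Aminus j).transpose)) ^ 2 := by
    intro j
    -- The eigenvalue bound is applied to `B = A_{-j} S` and `w = S a_j`, where `S = Σ_f^{1/2}`:
    -- then `w'w = a_j'Σ_f a_j` and `Bw = A_{-j} Σ_f a_j`.
    have hB : (M.Aminus j * S).rank = Fintype.card (Fin K) := by
      rw [rank_mul_eq_left_of_isUnit_det _ _ hSd, hR.rank_A, Fintype.card_fin]
    have hBB : (M.Aminus j * S) * (M.Aminus j * S)ᵀ =
        M.Aminus j * M.SigmaF P * (M.Aminus j).transpose := by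
      rw [transpose_mul, hST, ← hSS]
      simp only [Matrix.mul_assoc]
    obtain ⟨h1, h2⟩ := kthEig_mul_dotProduct_le hB (by simpa using hK)
    rw [hBB, Fintype.card_fin] at h1 h2
    refine ⟨h1, ?_⟩
    have h3 := h2 (S *ᵥ M.a j)
    have e1 : (S *ᵥ M.a j) ⬝ᵥ (S *ᵥ M.a j) = M.a j ⬝ᵥ M.SigmaF P *ᵥ M.a j := by
      rw [dotProduct_mulVec, ← mulVec_transpose, hST, mulVec_mulVec, hSS, dotProduct_comm]
    have e2 : (M.Aminus j * S) *ᵥ (S *ᵥ M.a j) =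
        Matrix.vecMul (M.a j) (M.SigmaF P * (M.Aminus j).transpose) := by
      rw [← mulVec_transpose, transpose_mul, transpose_transpose, mulVec_mulVec, ← hSS,
        transpose_mul, hST, Matrix.mul_assoc]
    rw [e1, e2] at h3
    refine h3.trans_eq ?_
    rw [eucNorm, EuclideanSpace.real_norm_sq_eq]
    simp [dotProduct, sq]
  have hxi : ∀ j, 0 < M.xi P j := fun j => div_pos (hkey j).1 (hc.trans_le (hspec j))
  have hxb : 0 < M.xiBar P := by
    obtain ⟨j, hj⟩ := exists_eq_ciInf_of_finite (f := M.xi P)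
    rw [xiBar, ← hj]
    exact hxi j
  have hd2 : ∀ j, eucNorm (Matrix.vecMul (M.a j) (M.SigmaF P * (M.Aminus j).transpose)) ≤
      M.d2 P := fun j => le_ciSup (f := fun j =>
        eucNorm (Matrix.vecMul (M.a j) (M.SigmaF P * (M.Aminus j).transpose)))
        (Set.finite_range _).bddAbove j
  have hen : ∀ j, 0 ≤ eucNorm (Matrix.vecMul (M.a j) (M.SigmaF P * (M.Aminus j).transpose)) :=
    fun j => norm_nonneg _
  refine ⟨hxb, (hen (Classical.arbitrary _)).trans (hd2 _), fun j => ?_⟩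
  have hq : 0 ≤ M.a j ⬝ᵥ M.SigmaF P *ᵥ M.a j := by
    simpa using (posSemidef_SigmaF hD).dotProduct_mulVec_nonneg (M.a j)
  have h1 : M.xiBar P ≤ M.xi P j := ciInf_le (Set.finite_range _).bddBelow j
  have h2 : c * M.xiBar P ≤ kthEig (M.Aminus j * M.SigmaF P * (M.Aminus j).transpose) K := by
    calc c * M.xiBar P ≤ specNorm (M.SigmaUminus P j) * M.xi P j :=
          mul_le_mul (hspec j) h1 hxb.le (hc.le.trans (hspec j))
      _ = _ := mul_div_cancel₀ _ (hc.trans_le (hspec j)).ne'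
  calc _ ≤ kthEig (M.Aminus j * M.SigmaF P * (M.Aminus j).transpose) K *
        (M.a j ⬝ᵥ M.SigmaF P *ᵥ M.a j) := mul_le_mul_of_nonneg_right h2 hq
    _ ≤ _ := (hkey j).2
    _ ≤ _ := by gcongr; exacts [hen j, hd2 j]

/-- The bias of the diagonal estimator. -/
lemma quadForm_le_rate (hn : 0 < n) (hN : M.NoiseBounds P c C) (hR : M.RankBounds P C)
    (hD : M.SubGaussianDesign P C γe γw γf) (hc : 0 < c) (hC : 0 < C) (hK : 1 ≤ K) (j : Fin p) :
    M.a j ⬝ᵥ M.SigmaF P *ᵥ M.a j ≤ √(C ^ 3 / c) * (√K * M.d2 P / √(M.xiBar P)) := by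
  obtain ⟨hx, hd, h⟩ := quadForm_mul_xiBar_le hn hN hR hD hc hK
  have hq : 0 ≤ M.a j ⬝ᵥ M.SigmaF P *ᵥ M.a j := by
    simpa using (posSemidef_SigmaF hD).dotProduct_mulVec_nonneg (M.a j)
  refine abs_le_of_sq_le_sq' ?_ (by positivity) |>.2
  rw [mul_pow, div_pow, mul_pow, Real.sq_sqrt (by positivity), Real.sq_sqrt (by positivity),
    Real.sq_sqrt hx.le]
  set q := M.a j ⬝ᵥ M.SigmaF P *ᵥ M.a j
  -- One factor is bounded by `C³K`, the other by `d₂² / (c ξ̄)`.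
  calc q ^ 2 = q * q := sq q
    _ ≤ (C ^ 3 * K) * (M.d2 P ^ 2 / (c * M.xiBar P)) := by
        refine mul_le_mul (quadForm_le hR hD hC hK j) ?_ hq (by positivity)
        rw [le_div_iff₀ (by positivity), mul_comm]
        exact h j
    _ = _ := by field_simp

variable [IsProbabilityMeasure P]

lemma memLp_f (hD : M.SubGaussianDesign P C γe γw γf) (t : Fin n) (k : Fin K) :
    MemLp (fun ω => M.f t ω k) 2 P := by
  obtain ⟨S, -, hg⟩ := hD.subG_f
  obtain ⟨g, -, hfg, hsub, -⟩ := hg t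
  simp only [hfg]
  exact memLp_dotProduct (memLp_of_isSubGVec_sub hsub) (S k)

/-- Independence of `u_j` from `U_{-j}` for every `j` kills all off-diagonal noise covariances, and
independence from `f` kills the cross terms. -/
lemma Sigma_eq (hn : 0 < n) (hS : M.Sampling P) (hD : M.SubGaussianDesign P C γe γw γf) :
    M.Sigma P = M.Aᵀ * M.SigmaF P * M.A + diagonal (M.sigmaSq P) := by
  set t : Fin n := ⟨0, hn⟩
  have hyc : M.Sigma P = covMat P (M.y t) := dif_pos hn
  have hfc : M.SigmaF P = covMat P (M.f t) := dif_pos hn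
  have huc : ∀ j, M.sigmaSq P j = covariance (fun ω => M.u t ω j) (fun ω => M.u t ω j) P := by
    intro j
    have : rowCov P M.u = covMat P (M.u t) := dif_pos hn
    rw [sigmaSq, this]
    rfl
  have hf := memLp_f hD t
  have hu := memLp_u hD t
  have hfa : ∀ i, MemLp (fun ω => M.a i ⬝ᵥ M.f t ω) 2 P := fun i => memLp_dotProduct hf _
  have hcross : ∀ i j, covariance (fun ω => M.a i ⬝ᵥ M.f t ω) (fun ω => M.u t ω j) P = 0 := by
    intro i j
    refine IndepFun.covariance_eq_zero ?_ (hfa i) (hu j)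
    exact (indepFun_f_u hS t j).comp (φ := fun x => M.a i ⬝ᵥ x)
      (by simp only [dotProduct]; fun_prop) measurable_id
  have hcross' : ∀ i j, covariance (fun ω => M.u t ω i) (fun ω => M.a j ⬝ᵥ M.f t ω) P = 0 :=
    fun i j => (covariance_comm _ _).trans (hcross j i)
  have hdiag : ∀ i j, covariance (fun ω => M.u t ω i) (fun ω => M.u t ω j) P =
      diagonal (M.sigmaSq P) i j := by
    intro i j
    by_cases hij : i = j
    · rw [hij, diagonal_apply_eq, huc]
    · rw [diagonal_apply_ne _ hij]
      exact (indepFun_u_u hS t hij).covariance_eq_zero (hu i) (hu j)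
  ext i j
  have h1 : M.Sigma P i j = covariance (fun ω => M.y t ω i) (fun ω => M.y t ω j) P := by
    rw [hyc]
    rfl
  rw [h1, y_eq, y_eq, covariance_add_left (hfa i) (hu i) ((hfa j).add (hu j)),
    covariance_add_right (hfa i) (hfa j) (hu j), covariance_add_right (hu i) (hfa j) (hu j),
    hcross, hcross', hdiag, covariance_dotProduct hf, ← hfc, add_zero, zero_add, Matrix.add_apply,
    mul_mul_apply_eq_dotProduct]
  rfl

lemma Sigma_diag (hn : 0 < n) (hS : M.Sampling P) (hD : M.SubGaussianDesign P C γe γw γf)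
    (j : Fin p) : M.Sigma P j j = M.a j ⬝ᵥ M.SigmaF P *ᵥ M.a j + M.sigmaSq P j := by
  rw [Sigma_eq hn hS hD, Matrix.add_apply, diagonal_apply_eq, mul_mul_apply_eq_dotProduct]
  rfl

lemma tauSq_bounds (hn : 0 < n) (hS : M.Sampling P) (hN : M.NoiseBounds P c C)
    (hD : M.SubGaussianDesign P C γe γw γf) (hc : 0 < c) (j : Fin p) :
    M.sigmaSq P j ≤ M.tauSq P j ∧ M.tauSq P j ≤ M.Sigma P j j := by
  have hG : (M.Aᵀ * M.SigmaF P * M.A).PosSemidef := by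
    simpa using (posSemidef_SigmaF hD).conjTranspose_mul_mul_same M.A
  have h := one_div_inv_diag_bounds hG (fun i => hc.trans_le (hN.sigmaSq_ge i)) j
  rwa [← Sigma_eq hn hS hD] at h

/-- The variance proxy, up to the factor `K`, of the outcomes. -/
def proxy (C γe γf : ℝ) : NNReal := Real.toNNReal (C ^ 3 * γf ^ 2 + C * γe ^ 2 + 1)

lemma coe_proxy (hC : 0 < C) : (proxy C γe γf : ℝ) = C ^ 3 * γf ^ 2 + C * γe ^ 2 + 1 :=
  Real.coe_toNNReal _ (by positivity)

lemma hasSubgaussianMGF_y_and_integral (hn : 0 < n) (hS : M.Sampling P)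
    (hN : M.NoiseBounds P c C) (hR : M.RankBounds P C)
    (hD : M.SubGaussianDesign P C γe γw γf) (hc : 0 < c) (hC : 0 < C) (hK : 1 ≤ K)
    (t : Fin n) (j : Fin p) :
    HasSubgaussianMGF (fun ω => M.y t ω j) (K * proxy C γe γf) P ∧
      ∫ ω, M.y t ω j ^ 2 ∂P = M.Sigma P j j := by
  -- All covariance matrices are read off the first row, so the claim is proved there and carried to
  -- `t` by identical distribution.
  set s : Fin n := ⟨0, hn⟩ with hs
  have hid : IdentDistrib (fun ω => M.y s ω j) (fun ω => M.y t ω j) P P :=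
    (hS.iid_y.2 s t).comp (measurable_pi_apply j)
  suffices h : HasSubgaussianMGF (fun ω => M.y s ω j) (K * proxy C γe γf) P ∧
      ∫ ω, M.y s ω j ^ 2 ∂P = M.Sigma P j j by
    refine ⟨h.1.congr_identDistrib hid, ?_⟩
    rw [← h.2]
    exact ((hid.comp (u := fun x : ℝ => x ^ 2) (by fun_prop)).integral_eq).symm
  obtain ⟨S, ⟨hSp, hSS⟩, hg⟩ := hD.subG_f
  obtain ⟨g, -, hfg, hsub, hiso⟩ := hg s
  have hST : Sᵀ = S := (conjTranspose_eq_transpose_of_trivial S).symm.trans hSp.1.eq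
  have hgL : ∀ k, MemLp (fun ω => g ω k) 2 P := memLp_of_isSubGVec_sub hsub
  have hSu : IsUnit S := by
    have h : IsUnit (M.SigmaF P) := isUnit_of_rank_eq_card (by simpa using hR.rank_F)
    rw [← hSS] at h
    exact isUnit_of_mul_isUnit_left h
  have hcov : covMat P (fun ω => S *ᵥ g ω) = S * Sᵀ := by
    have : M.SigmaF P = covMat P (M.f s) := dif_pos hn
    rw [hST, hSS, this, funext hfg]
  -- Hence the factors are centred, and the second moment of `y_{jt}` is `Σ_jj` itself.
  have hg0 := integral_eq_zero_of_isotropic hgL hiso hSu hcov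
  simp only [hg0, sub_zero] at hsub
  set w := S *ᵥ M.a j with hw
  have hww : w ⬝ᵥ w = M.a j ⬝ᵥ M.SigmaF P *ᵥ M.a j := by
    rw [hw, dotProduct_mulVec, ← mulVec_transpose, hST, mulVec_mulVec, hSS, dotProduct_comm]
  have haf : (fun ω => M.a j ⬝ᵥ M.f s ω) = fun ω => w ⬝ᵥ g ω := by
    ext ω
    rw [hfg, dotProduct_mulVec, ← mulVec_transpose, hST]
  have hf := hsub.hasSubgaussianMGF_dotProduct w
  rw [← haf] at hf
  have hu := hD.subG_u s j
  have hindep : IndepFun (fun ω => M.a j ⬝ᵥ M.f s ω) (fun ω => M.u s ω j) P :=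
    (indepFun_f_u hS s j).comp (φ := fun x => M.a j ⬝ᵥ x)
      (by simp only [dotProduct]; fun_prop) measurable_id
  have hy : (fun ω => M.y s ω j) = fun ω => M.a j ⬝ᵥ M.f s ω + M.u s ω j := y_eq s j
  have hsum : HasSubgaussianMGF (fun ω => M.y s ω j) (K * proxy C γe γf) P := by
    rw [hy]
    refine hasSubgaussianMGF_mono (hf.add_of_indepFun hu hindep) ?_
    have hσ : 0 ≤ M.sigmaSq P j := hc.le.trans (hN.sigmaSq_ge j)
    have hq := quadForm_le hR hD hC hK j
    have hq0 : 0 ≤ w ⬝ᵥ w := by simpa using dotProduct_star_self_nonneg w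
    have hK' : (1 : ℝ) ≤ K := by exact_mod_cast hK
    rw [← NNReal.coe_le_coe, NNReal.coe_add, NNReal.coe_mul, Real.coe_toNNReal _ (by positivity),
      Real.coe_toNNReal _ (by positivity), coe_proxy hC, mul_pow, Real.sq_sqrt hσ,
      NNReal.coe_natCast]
    calc γf ^ 2 * (w ⬝ᵥ w) + M.sigmaSq P j * γe ^ 2
        ≤ γf ^ 2 * (C ^ 3 * K) + C * γe ^ 2 := by
          gcongr
          · exact hww ▸ hq
          · exact hN.sigmaSq_le j
      _ ≤ γf ^ 2 * (C ^ 3 * K) + K * (C * γe ^ 2 + 1) := by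
          nlinarith [mul_nonneg hC.le (sq_nonneg γe)]
      _ = _ := by ring
  refine ⟨hsum, ?_⟩
  have hmean : ∫ ω, M.y s ω j ∂P = 0 := by
    rw [hy, integral_add hf.integrable (hS.integrable_u s j), hS.mean_u, add_zero, haf]
    simp only [dotProduct]
    rw [integral_finsetSum _ fun k _ => ((hgL k).integrable one_le_two).const_mul (w k)]
    simp only [integral_const_mul, hg0, mul_zero, Finset.sum_const_zero]
  have hvar : M.Sigma P j j = covariance (fun ω => M.y s ω j) (fun ω => M.y s ω j) P := by
    have : M.Sigma P = covMat P (M.y s) := dif_pos hn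
    rw [this]
    rfl
  rw [hvar, covariance_eq_sub (hsum.memLp 2) (hsum.memLp 2), hmean]
  simp [sq]

lemma tauHatSq_sub_eq {Ω : Type*} {n p K : ℕ} {M : FactorModel Ω n p K} (hn : 0 < n) (j : Fin p) (ω : Ω) (m : ℝ) :
    n * (M.tauHatSq j ω - m) = ∑ t, (M.y t ω j ^ 2 - m) := by
  have : (n : ℝ) ≠ 0 := by positivity
  simp only [tauHatSq, ← sq, Finset.sum_sub_distrib, Finset.sum_const, Finset.card_univ,
    Fintype.card_fin, nsmul_eq_mul]
  field_simp

/-- Uniform concentration of the diagonal estimators around `Σ_jj`. -/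
lemma measureReal_exists_tauHatSq_le (hn : 0 < n) (hS : M.Sampling P)
    (hN : M.NoiseBounds P c C) (hR : M.RankBounds P C)
    (hD : M.SubGaussianDesign P C γe γw γf) (hc : 0 < c) (hC : 0 < C) (hK : 1 ≤ K)
    {θ ε : ℝ} (hθ0 : 0 ≤ θ) (hθ : 8 * θ ≤ 1) :
    P.real {ω | ∃ j, proxy C γe γf * ε * K ≤ |M.tauHatSq j ω - M.Sigma P j j|} ≤
      p * (2 * Real.exp (-(n * (θ * ε - 512 * θ ^ 2)))) := by
  have hn' : (0 : ℝ) < n := by positivity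
  have hv : 0 < (K : NNReal) * proxy C γe γf := by
    refine mul_pos (by exact_mod_cast hK) ?_
    rw [← NNReal.coe_lt_coe, coe_proxy hC, NNReal.coe_zero]
    positivity
  have hj : ∀ j, P.real {ω | proxy C γe γf * ε * K ≤ |M.tauHatSq j ω - M.Sigma P j j|} ≤
      2 * Real.exp (-(n * (θ * ε - 512 * θ ^ 2))) := by
    intro j
    have h := measureReal_sum_sq_ge_le (X := fun t ω => M.y t ω j) (ε := ε)
      (hS.iid_y.1.comp (fun _ x => x j) fun _ => measurable_pi_apply j)
      (fun t => (hasSubgaussianMGF_y_and_integral hn hS hN hR hD hc hC hK t j).1)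
      (fun t => (measurable_pi_apply j).comp (measurable_y hS t))
      (fun t => (hasSubgaussianMGF_y_and_integral hn hS hN hR hD hc hC hK t j).2) hv hθ0 hθ
    refine le_trans (le_of_eq ?_) h
    congr 1
    ext ω
    rw [Set.mem_ofPred_eq, Set.mem_ofPred_eq, ← tauHatSq_sub_eq hn, abs_mul, abs_of_pos hn',
      mul_assoc (n : ℝ), mul_le_mul_iff_right₀ hn', NNReal.coe_mul, NNReal.coe_natCast]
    ring_nf
  have hU : {ω | ∃ j, proxy C γe γf * ε * K ≤ |M.tauHatSq j ω - M.Sigma P j j|} =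
      ⋃ j, {ω | proxy C γe γf * ε * K ≤ |M.tauHatSq j ω - M.Sigma P j j|} := by
    ext ω
    simp
  rw [hU]
  refine (measureReal_iUnion_fintype_le _).trans ((Finset.sum_le_sum fun j _ => hj j).trans_eq ?_)
  simp

end FactorModel

/-! ### Choice of the Chernoff parameter and the nonasymptotic error bound. -/

namespace FactorModel

variable {Ω : Type*} [MeasurableSpace Ω] {P : Measure Ω} {n p K : ℕ}
  {M : FactorModel Ω n p K} {c C Cp γe γw γf : ℝ}

lemma maxErr_nonneg (ω : Ω) : 0 ≤ M.maxErr P ω := Real.iSup_nonneg fun _ => abs_nonneg _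

lemma rate_nonneg : 0 ≤ √K * M.d2 P / √(M.xiBar P) := by
  have : 0 ≤ M.d2 P := Real.iSup_nonneg fun _ => norm_nonneg _
  positivity

/-- The multiplier of `√(log p / n)` in the Chernoff parameter. -/
def chernoffScale (Cp : ℝ) : ℝ := 1 / (8 * (1 + Cp))

/-- The constant in the stochastic part of the error bound. -/
def devConst (C Cp γe γf : ℝ) : ℝ :=
  proxy C γe γf * ((2 + 512 * chernoffScale Cp ^ 2) / chernoffScale Cp)

lemma devConst_nonneg (hCp : 0 < Cp) : 0 ≤ devConst C Cp γe γf := by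
  unfold devConst chernoffScale
  positivity

variable [IsProbabilityMeasure P]

lemma measureReal_exists_tauHatSq_le_div (hn : 0 < n) (hS : M.Sampling P)
    (hN : M.NoiseBounds P c C) (hR : M.RankBounds P C)
    (hD : M.SubGaussianDesign P C γe γw γf) (hc : 0 < c) (hC : 0 < C) (hK : 1 ≤ K)
    (hCp : 0 < Cp) (hp : (p : ℝ) ≤ Real.exp (Cp * n / 2) / 4) :
    P.real {ω | ∃ j, devConst C Cp γe γf * (K * √(Real.log p / n)) ≤
      |M.tauHatSq j ω - M.Sigma P j j|} ≤ 2 / p := by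
  have hn' : (0 : ℝ) < n := by positivity
  have hp1 : 1 ≤ p := by have := hR.dim; omega
  have hp0 : (0 : ℝ) < p := by exact_mod_cast hp1
  have hlog0 : 0 ≤ Real.log p := Real.log_nonneg (by exact_mod_cast hp1)
  have hlog : Real.log p ≤ Cp * n / 2 := by
    rw [Real.log_le_iff_le_exp hp0]
    linarith [Real.exp_pos (Cp * n / 2)]
  set η := √(Real.log p / n) with hη
  have hη2 : η ^ 2 = Real.log p / n := Real.sq_sqrt (by positivity)
  -- Since `η² ≤ Cp / 2`; this keeps `8θ ≤ 1` for `θ = chernoffScale Cp * η`.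
  have hη1 : η ≤ 1 + Cp := by
    refine Real.sqrt_le_left (by positivity) |>.2 ?_
    rw [div_le_iff₀ hn']
    nlinarith [mul_pos hCp hn', mul_pos (mul_pos hCp hCp) hn']
  have hθ : 0 < chernoffScale Cp := by unfold chernoffScale; positivity
  have h8 : 8 * (chernoffScale Cp * η) ≤ 1 := by
    calc 8 * (chernoffScale Cp * η) ≤ 8 * (chernoffScale Cp * (1 + Cp)) := by gcongr
      _ = 1 := by unfold chernoffScale; field_simp
  have h := measureReal_exists_tauHatSq_le hn hS hN hR hD hc hC hK
    (θ := chernoffScale Cp * η)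
    (ε := (2 + 512 * chernoffScale Cp ^ 2) / chernoffScale Cp * η) (by positivity) h8
  -- The factor in `ε` is solved from `θε - 512θ² = 2η²`: each outcome then fails with probability
  -- at most `2 / p²`, and the union over `p` outcomes costs `2 / p`.
  have hexp : n * (chernoffScale Cp * η * ((2 + 512 * chernoffScale Cp ^ 2) /
      chernoffScale Cp * η) - 512 * (chernoffScale Cp * η) ^ 2) = 2 * Real.log p := by
    have : chernoffScale Cp * η * ((2 + 512 * chernoffScale Cp ^ 2) / chernoffScale Cp * η) -
        512 * (chernoffScale Cp * η) ^ 2 = 2 * η ^ 2 := by field_simp; ring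
    rw [this, hη2]
    field_simp
  rw [hexp] at h
  have hset : ∀ ω, (∃ j, devConst C Cp γe γf * (K * η) ≤ |M.tauHatSq j ω - M.Sigma P j j|) ↔
      ∃ j, proxy C γe γf * ((2 + 512 * chernoffScale Cp ^ 2) / chernoffScale Cp * η) * K ≤
        |M.tauHatSq j ω - M.Sigma P j j| := by
    intro ω
    refine exists_congr fun j => ?_
    unfold devConst
    ring_nf
  simp only [hset]
  refine h.trans_eq ?_
  have : Real.exp (-(2 * Real.log p)) = ((p : ℝ) ^ 2)⁻¹ := by
    rw [Real.exp_neg, two_mul, Real.exp_add, Real.exp_log hp0, sq]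
  rw [this]
  field_simp

/-- Nonasymptotic form of the convergence rate. -/
lemma measure_lt_maxErr_le (hn : 0 < n) (hS : M.Sampling P)
    (hN : M.NoiseBounds P c C) (hR : M.RankBounds P C)
    (hD : M.SubGaussianDesign P C γe γw γf) (hc : 0 < c) (hC : 0 < C) (hK : 1 ≤ K)
    (hCp : 0 < Cp) (hp : (p : ℝ) ≤ Real.exp (Cp * n / 2) / 4) :
    P {ω | devConst C Cp γe γf * (K * √(Real.log p / n)) +
      √(C ^ 3 / c) * (√K * M.d2 P / √(M.xiBar P)) < M.maxErr P ω} ≤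
      ENNReal.ofReal (2 / p) := by
  have : Nonempty (Fin p) := ⟨⟨0, by have := hR.dim; omega⟩⟩
  have h := measureReal_exists_tauHatSq_le_div hn hS hN hR hD hc hC hK hCp hp
  refine le_trans (measure_mono fun ω hω => ?_)
    ((ENNReal.le_ofReal_iff_toReal_le (measure_ne_top _ _) (by positivity)).2 h)
  by_contra hne
  rw [Set.mem_ofPred_eq] at hω hne
  push Not at hne
  refine hω.not_ge (ciSup_le fun j => ?_)
  have hb := tauSq_bounds hn hS hN hD hc j
  have hq := quadForm_le_rate hn hN hR hD hc hC hK j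
  have hd := Sigma_diag hn hS hD j
  calc |M.tauHatSq j ω - M.tauSq P j|
      ≤ |M.tauHatSq j ω - M.Sigma P j j| + |M.Sigma P j j - M.tauSq P j| := abs_sub_le _ _ _
    _ ≤ _ := by
      refine add_le_add (hne j).le ?_
      rw [abs_of_nonneg (by linarith)]
      linarith

end FactorModel

/-! ### Passage to stochastic orders. -/

lemma tendsto_ofReal_two_div {p : ℕ → ℕ} (hp : ∀ n, 1 ≤ n → n + 1 < p n) :
    Tendsto (fun n => ENNReal.ofReal (2 / p n)) atTop (𝓝 0) := by
  have h1 : Tendsto p atTop atTop :=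
    tendsto_atTop_mono' _ ((eventually_ge_atTop 1).mono fun n hn => by simp only [id]; have := hp n hn; omega)
      tendsto_id
  have h2 : Tendsto (fun n => (2 : ℝ) / p n) atTop (𝓝 0) :=
    (tendsto_natCast_atTop_atTop.comp h1).const_div_atTop 2
  simpa using ENNReal.tendsto_ofReal h2

section Asymptotics

variable {Ω : ℕ → Type*} [∀ n, MeasurableSpace (Ω n)] {P : ∀ n, Measure (Ω n)}
  {p K : ℕ → ℕ} {M : ∀ n, FactorModel (Ω n) n (p n) (K n)}
  {d₁ : ℕ → ℝ} {c C Cp γe γw γf : ℝ}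

lemma Assumptions.C_pos (hM : Assumptions P p K M d₁ c C Cp γe γw γf) : 0 < C := by
  have h := hM.noise 1 le_rfl
  have hp := hM.interpolation 1 le_rfl
  exact hM.c_pos.trans_le ((h.sigmaSq_ge ⟨0, by omega⟩).trans (h.sigmaSq_le ⟨0, by omega⟩))

variable [∀ n, IsProbabilityMeasure (P n)]

lemma Assumptions.measure_lt_maxErr_le (hM : Assumptions P p K M d₁ c C Cp γe γw γf) {n : ℕ}
    (hn : 1 ≤ n) :
    P n {ω | FactorModel.devConst C Cp γe γf * (K n * √(Real.log (p n) / n)) +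
      √(C ^ 3 / c) * (√(K n) * (M n).d2 (P n) / √((M n).xiBar (P n))) < (M n).maxErr (P n) ω} ≤
      ENNReal.ofReal (2 / p n) :=
  FactorModel.measure_lt_maxErr_le hn (hM.sampling n hn) (hM.noise n hn) (hM.rank n hn)
    (hM.subG n hn) hM.c_pos hM.C_pos (hM.K_pos n hn) hM.Cp_pos (hM.p_le n hn)

lemma Assumptions.exists_rate (hM : Assumptions P p K M d₁ c C Cp γe γw γf) :
    ∃ X Z : ∀ n, Ω n → ℝ,
      IsBigOp P X (fun n => √(K n) * (M n).d2 (P n) / √((M n).xiBar (P n))) ∧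
      IsBigOp P Z
        (fun n => max ((K n : ℝ) ^ (3 / 2 : ℝ) / √n) (K n * √(Real.log (p n) / n))) ∧
      ∀ n, 1 ≤ n → ∀ ω, (M n).maxErr (P n) ω = X n ω + Z n ω := by
  set a : ℕ → ℝ := fun n => √(K n) * (M n).d2 (P n) / √((M n).xiBar (P n)) with ha
  have ha0 : ∀ n, 0 ≤ a n := fun n => FactorModel.rate_nonneg
  have hX0 : ∀ n ω, 0 ≤ min ((M n).maxErr (P n) ω) (√(C ^ 3 / c) * a n) := fun n ω =>
    le_min (FactorModel.maxErr_nonneg ω) (mul_nonneg (Real.sqrt_nonneg _) (ha0 n))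
  -- Truncating the error at the bias bound gives the first term; the excess over it is the second,
  -- and it is nonzero only where the error exceeds the bias bound.
  refine ⟨fun n ω => min ((M n).maxErr (P n) ω) (√(C ^ 3 / c) * a n),
    fun n ω => (M n).maxErr (P n) ω - min ((M n).maxErr (P n) ω) (√(C ^ 3 / c) * a n),
    fun ε _ => ⟨√(C ^ 3 / c), Eventually.of_forall fun n => ?_⟩,
    fun ε hε => ⟨FactorModel.devConst C Cp γe γf, ?_⟩, fun n _ ω => by ring⟩
  · have : {ω | √(C ^ 3 / c) * |a n| < |min ((M n).maxErr (P n) ω) (√(C ^ 3 / c) * a n)|} = ∅ := by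
      ext ω
      rw [Set.mem_ofPred_eq, abs_of_nonneg (ha0 n), abs_of_nonneg (hX0 n ω)]
      simp
    rw [this, measure_empty]
    exact zero_le
  · have hev := (tendsto_ofReal_two_div hM.interpolation).eventually
      (ge_mem_nhds (ENNReal.ofReal_pos.2 hε))
    filter_upwards [hev, eventually_ge_atTop 1] with n hn hn1
    refine le_trans (measure_mono fun ω hω => ?_) ((hM.measure_lt_maxErr_le hn1).trans hn)
    rw [Set.mem_ofPred_eq] at hω ⊢
    -- The deviation bound already lies below the second entry of the maximum.
    have hb : K n * √(Real.log (p n) / n) ≤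
        |max ((K n : ℝ) ^ (3 / 2 : ℝ) / √n) (K n * √(Real.log (p n) / n))| :=
      (le_max_right _ _).trans (le_abs_self _)
    have hb' := mul_le_mul_of_nonneg_left hb
      (FactorModel.devConst_nonneg (C := C) (γe := γe) (γf := γf) hM.Cp_pos)
    have hb0 : 0 ≤ FactorModel.devConst C Cp γe γf * (K n * √(Real.log (p n) / n)) :=
      mul_nonneg (FactorModel.devConst_nonneg hM.Cp_pos) (by positivity)
    rw [abs_of_nonneg (sub_nonneg.2 (min_le_left _ _))] at hω
    rcases min_choice ((M n).maxErr (P n) ω) (√(C ^ 3 / c) * a n) with h | h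
    · rw [h, sub_self] at hω
      linarith
    · rw [h] at hω
      linarith

lemma Assumptions.isLittleOpOne_maxErr (hM : Assumptions P p K M d₁ c C Cp γe γw γf)
    (h1 : Tendsto (fun n : ℕ => K n * √(max (Real.log (p n)) (Real.log n)) / √n) atTop (𝓝 0))
    (h2 : Tendsto (fun n : ℕ => √(K n) * (M n).d2 (P n) / √((M n).xiBar (P n))) atTop (𝓝 0)) :
    IsLittleOpOne P (fun n => (M n).maxErr (P n)) := by
  have h3 : Tendsto (fun n : ℕ => K n * √(Real.log (p n) / n)) atTop (𝓝 0) := by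
    refine squeeze_zero (fun n => by positivity) (fun n => ?_) h1
    rw [Real.sqrt_div' _ (Nat.cast_nonneg n), mul_div_assoc]
    gcongr
    exact le_max_left _ _
  have h4 := (h3.const_mul (FactorModel.devConst C Cp γe γf)).add (h2.const_mul √(C ^ 3 / c))
  simp only [mul_zero, add_zero] at h4
  intro ε hε
  refine tendsto_of_tendsto_of_tendsto_of_le_of_le' tendsto_const_nhds
    (tendsto_ofReal_two_div hM.interpolation) (Eventually.of_forall fun n => zero_le) ?_
  filter_upwards [h4.eventually (ge_mem_nhds hε), eventually_ge_atTop 1] with n hn hn1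
  refine le_trans (measure_mono fun ω hω => ?_) (hM.measure_lt_maxErr_le hn1)
  rw [Set.mem_ofPred_eq, abs_of_nonneg (FactorModel.maxErr_nonneg ω)] at hω
  exact hn.trans_lt hω

lemma Assumptions.le_iInf_tauSq (hM : Assumptions P p K M d₁ c C Cp γe γw γf) {n : ℕ}
    (hn : 1 ≤ n) : c ≤ ⨅ j, (M n).tauSq (P n) j := by
  have : Nonempty (Fin (p n)) := ⟨⟨0, by have := hM.interpolation n hn; omega⟩⟩
  exact le_ciInf fun j => ((hM.noise n hn).sigmaSq_ge j).trans
    (FactorModel.tauSq_bounds hn (hM.sampling n hn) (hM.noise n hn) (hM.subG n hn) hM.c_pos j).1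

end Asymptotics

end HiddenFactor

end

theorem mainTheorem11 {Ω : ℕ → Type*} [∀ n, MeasurableSpace (Ω n)]
    (P : ∀ n, MeasureTheory.Measure (Ω n)) [∀ n, MeasureTheory.IsProbabilityMeasure (P n)]
    (p K : ℕ → ℕ) (M : ∀ n, HiddenFactor.FactorModel (Ω n) n (p n) (K n))
    (d₁ : ℕ → ℝ) (c C Cp γe γw γf : ℝ)
    (hM : HiddenFactor.Assumptions P p K M d₁ c C Cp γe γw γf) :
    -- rate of convergence
    (∃ X Z : ∀ n, Ω n → ℝ,
      HiddenFactor.IsBigOp P X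
        (fun n => √(K n) * (M n).d2 (P n) / √((M n).xiBar (P n))) ∧
      HiddenFactor.IsBigOp P Z
        (fun n => max ((K n : ℝ) ^ (3 / 2 : ℝ) / √n) (K n * √(Real.log (p n) / n))) ∧
      ∀ n, 1 ≤ n → ∀ ω, (M n).maxErr (P n) ω = X n ω + Z n ω) ∧
    -- consistency, and lower bound
    (Filter.Tendsto (fun n : ℕ => √((K n : ℝ) ^ 3 / n)) Filter.atTop (nhds 0) →
      Filter.Tendsto (fun n : ℕ => K n * √(max (Real.log (p n)) (Real.log n)) / √n)
        Filter.atTop (nhds 0) →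
      Filter.Tendsto (fun n : ℕ => √(K n) * (M n).d2 (P n) / √((M n).xiBar (P n)))
        Filter.atTop (nhds 0) →
      HiddenFactor.IsLittleOpOne P (fun n => (M n).maxErr (P n)) ∧
      ∃ R : ∀ n, Ω n → ℝ, HiddenFactor.IsLittleOpOne P R ∧
        ∀ n, 1 ≤ n → ∀ ω, c - R n ω ≤ ⨅ j, (M n).tauSq (P n) j) := by
  -- The remainder in the lower bound can be zero, because `τ_j² ≥ σ_j² ≥ c` holds exactly.
  exact ⟨hM.exists_rate, fun _ h1 h2 => ⟨hM.isLittleOpOne_maxErr h1 h2, fun _ _ => 0,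
    fun ε hε => by simp [hε.not_gt], fun n hn ω => by simpa using hM.le_iInf_tauSq hn⟩⟩
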